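/- All graphs are finite, simple and undirected. For integers $k\ge 1$ and $a_1\ge a_2\ge\dots\ge a_k\ge 1$, let $F_{a_1,\dots,a_k}$ be the graph consisting of $k$ cycles of odd lengths $2a_1+1,\dots,2a_k+1$ that share one common vertex and are otherwise pairwise vertex-disjoint. A graph is $H$-free if it contains no subgraph (not necessarily induced) isomorphic to $H$. For a graph $G$ with adjacency matrix $A(G)$ and diagonal degree matrix $D(G)$, let $q(G)$ be the largest eigenvalue of the signless Laplacian matrix $Q(G)=D(G)+A(G)$. For $0\le t\le n$, let $S_{n,t}=K_t\nabla\overline{K}_{n-t}$ be the join of the complete graph on $t$ vertices and the edgeless graph on $n-t$ vertices. **Theorem.** Let $k\ge 2$, let $a_1\ge a_2\ge\dots\ge a_k\ge 1$ be integers with $a_1\ge 2$, and put $t=\sum_{i=1}^k a_i$. Let $G$ be an $F_{a_1,\dots,a_k}$-free graph on $n\ge 8t^2-12t+9$ vertices. Then $$q(G)\le q(S_{n,t}),$$ with equality if and only if $G$ is isomorphic to $S_{n,t}$. -/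

import Mathlib

namespace SignlessLaplacian

open SimpleGraph

/-- The signless Laplacian matrix `Q(G) = D(G) + A(G)`. -/
def signlessLapMatrix {V : Type*} [Fintype V] [DecidableEq V] (G : SimpleGraph V)
    [DecidableRel G.Adj] : Matrix V V ℝ :=
  G.degMatrix ℝ + G.adjMatrix ℝ

open Classical in
/-- The signless Laplacian spectral radius `q(G)`: the largest eigenvalue of `Q(G)`
(see `isGreatest_q` for the fact that the supremum is attained). -/
noncomputable def q {V : Type*} [Fintype V] (G : SimpleGraph V) : ℝ :=
  sSup (spectrum ℝ (signlessLapMatrix G))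

theorem isHermitian_signlessLapMatrix {V : Type*} [Fintype V] [DecidableEq V]
    (G : SimpleGraph V) [DecidableRel G.Adj] : (signlessLapMatrix G).IsHermitian := by
  have h : (signlessLapMatrix G).IsSymm :=
    (G.isSymm_degMatrix (R := ℝ)).add (G.isSymm_adjMatrix (α := ℝ))
  rw [Matrix.IsHermitian, Matrix.conjTranspose_eq_transpose_of_trivial]
  exact h

open Classical in
theorem isGreatest_q {V : Type*} [Fintype V] [Nonempty V] (G : SimpleGraph V) :
    IsGreatest (spectrum ℝ (signlessLapMatrix G)) (q G) := by
  have h := (isHermitian_signlessLapMatrix G).spectrum_real_eq_range_eigenvalues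
  have hfin : (spectrum ℝ (signlessLapMatrix G)).Finite := by
    rw [h]; exact Set.finite_range _
  have hne : (spectrum ℝ (signlessLapMatrix G)).Nonempty := by
    rw [h]; exact Set.range_nonempty _
  exact ⟨hne.csSup_mem hfin, fun x hx => le_csSup hfin.bddAbove hx⟩

/-- The join `G ∇ H`: the disjoint union of `G` and `H` together with all edges between them. -/
def join {V W : Type*} (G : SimpleGraph V) (H : SimpleGraph W) : SimpleGraph (V ⊕ W) :=
  (G ⊕g H) ⊔ completeBipartiteGraph V W

/-- `S_{n,t} = K_t ∇ (complement of K_{n-t})`, a graph of order `n` when `t ≤ n`. -/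
def S (n t : ℕ) : SimpleGraph (Fin t ⊕ Fin (n - t)) :=
  join (completeGraph (Fin t)) (emptyGraph (Fin (n - t)))

/-- The vertices of `k` cycles of lengths `2 a_i + 1` glued at one vertex:
`none` is the common vertex, and `some ⟨i, x⟩` is the vertex `x + 1` of the `i`-th cycle. -/
abbrev CycleVertex {k : ℕ} (a : Fin k → ℕ) : Type :=
  Option (Σ i : Fin k, Fin (2 * a i))

/-- The placement of the `i`-th cycle: its vertex `0` goes to the common vertex. -/
def cycleEmb {k : ℕ} (a : Fin k → ℕ) (i : Fin k) : Fin (2 * a i + 1) ↪ CycleVertex a where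
  toFun := Fin.cases none (fun x => some ⟨i, x⟩)
  inj' := by
    intro x y
    refine Fin.cases ?_ (fun x => ?_) x <;> refine Fin.cases ?_ (fun y => ?_) y <;> simp

/-- `F_{a_1,…,a_k}`: the union of `k` odd cycles, of lengths `2 a_1 + 1, …, 2 a_k + 1`, which
pairwise intersect in exactly one common vertex. -/
def F {k : ℕ} (a : Fin k → ℕ) : SimpleGraph (CycleVertex a) :=
  ⨆ i : Fin k, (cycleGraph (2 * a i + 1)).map (cycleEmb a i)

end SignlessLaplacian

namespace SignlessLaplacian

open SimpleGraph Finset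

/-! ### Spectral estimates and the value of q(S_{n,t}). -/

section Spectral

variable {V : Type*} [Fintype V]

/-! Write Q = `qS n t`, which is q(S_{n,t}), and suppose q(G) ≥ Q. The bound of q(G) by the maximum
of d(u) + m(u) gives a vertex u whose neighbourhood N spans at least d(u)(Q - n) ordered adjacent
pairs, plus one for each nonadjacent pair between N and the vertices far from u
(`exists_innerPairs_ge`). Since Q is just below n + 2t - 2, the average degree inside N is almost 2t
- 2.

A path on 2t vertices of N, cut into pieces of 2a_i vertices, forms a copy of F together with u. So
N is nearly extremal for an Erdős–Gallai type problem. A smallest subset U of N keeping the excess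
over (2t - 3)|U| is connected (`DenseIn.preconnected`), and if |U| ≥ 2t it consists of a set A of t
- 1 vertices completely joined to an independent set (`exists_core_of_dense`, with m = t - 1). The
alternative |U| = 2t - 1 makes n too small, by `card_farVertices_lt`.

Further copies of F show that u is adjacent to every other vertex and that, for T = A ∪ {u}, a
vertex off T has all its neighbours in T, or meets T only in u and has few neighbours elsewhere
(`exists_core_of_qS_le`). The Perron vector of S_{n,t}, placed on T and its complement, then has all
its row sums in G at most Q times its entries. Hence q(G) ≤ Q, and equality spreads through u to all
rows and forces G ≅ S_{n,t} (`q_le_and_nonempty_iso_of_core`). -/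

open Classical in
/-- The entry at `i` of `Q(G) z`. -/
noncomputable def rowSum (G : SimpleGraph V) (z : V → ℝ) (i : V) : ℝ :=
  ∑ j with G.Adj i j, (z i + z j)

open Classical in
theorem signlessLapMatrix_mulVec (G : SimpleGraph V) (z : V → ℝ) (i : V) :
    (signlessLapMatrix G).mulVec z i = rowSum G z i := by
  rw [signlessLapMatrix, Matrix.add_mulVec, Pi.add_apply, degMatrix_mulVec_apply,
    adjMatrix_mulVec_apply, rowSum, Finset.sum_add_distrib, Finset.sum_const, nsmul_eq_mul,
    ← card_neighborFinset_eq_degree, neighborFinset_eq_filter]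

theorem exists_eigenvector [Nonempty V] (G : SimpleGraph V) :
    ∃ y : V → ℝ, y ≠ 0 ∧ ∀ i, rowSum G y i = q G * y i := by
  classical
  have h := (isGreatest_q G).1
  rw [← Matrix.spectrum_toLin', ← Module.End.hasEigenvalue_iff_mem_spectrum] at h
  obtain ⟨y, hy⟩ := h.exists_hasEigenvector
  refine ⟨y, hy.2, fun i => ?_⟩
  have := congrFun hy.apply_eq_smul i
  rw [Matrix.toLin'_apply, Pi.smul_apply, smul_eq_mul] at this
  rw [← this]
  convert (signlessLapMatrix_mulVec G y i).symm

theorem le_q_of_eigenvector (G : SimpleGraph V) {y : V → ℝ} {c : ℝ} (hy : y ≠ 0)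
    (h : ∀ i, rowSum G y i = c * y i) : c ≤ q G := by
  classical
  have : Nonempty V := by
    by_contra hne
    rw [not_nonempty_iff] at hne
    exact hy (Subsingleton.elim _ _)
  refine (isGreatest_q G).2 ?_
  rw [← Matrix.spectrum_toLin', ← Module.End.hasEigenvalue_iff_mem_spectrum]
  refine Module.End.hasEigenvalue_of_hasEigenvector (x := y) ⟨?_, hy⟩
  rw [Module.End.mem_eigenspace_iff]
  ext i
  rw [Matrix.toLin'_apply, Pi.smul_apply, smul_eq_mul, ← h i]
  convert signlessLapMatrix_mulVec G y i

/-- At the vertices maximizing `|y| / z`, for an eigenvector `y` of `q(G)`, the row of `Q(G) z`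
is at least `q(G) z`; if it is equal, all neighbours maximize `|y| / z` as well. -/
theorem exists_rowSum_ge [Nonempty V] (G : SimpleGraph V) {z : V → ℝ} (hz : ∀ i, 0 < z i) :
    ∃ I : Set V, I.Nonempty ∧ (∀ i ∈ I, q G * z i ≤ rowSum G z i) ∧
      ∀ i ∈ I, rowSum G z i ≤ q G * z i → ∀ j, G.Adj i j → j ∈ I := by
  classical
  obtain ⟨y, hy0, hy⟩ := exists_eigenvector G
  obtain ⟨i₀, -, hi₀⟩ := Finset.exists_max_image univ (fun i => |y i| / z i) univ_nonempty
  set M := |y i₀| / z i₀ with hM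
  have hle : ∀ j, |y j| ≤ M * z j := fun j => by
    have := hi₀ j (mem_univ j)
    rwa [div_le_iff₀ (hz j)] at this
  have hMpos : 0 < M := by
    obtain ⟨j, hj⟩ := Function.ne_iff.1 hy0
    have h1 : 0 < |y j| := abs_pos.2 hj
    have h2 := hle j
    by_contra hneg
    have : M * z j ≤ 0 := mul_nonpos_of_nonpos_of_nonneg (not_lt.1 hneg) (hz j).le
    linarith
  have key : ∀ i, q G * |y i| ≤ ∑ j with G.Adj i j, (|y i| + |y j|) := fun i => by
    calc q G * |y i| ≤ |q G| * |y i| :=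
          mul_le_mul_of_nonneg_right (le_abs_self _) (abs_nonneg _)
      _ = |rowSum G y i| := by rw [hy, abs_mul]
      _ ≤ ∑ j with G.Adj i j, |y i + y j| := abs_sum_le_sum_abs _ _
      _ ≤ _ := Finset.sum_le_sum fun j _ => abs_add_le _ _
  refine ⟨{i | |y i| = M * z i}, ⟨i₀, ?_⟩, ?_, ?_⟩
  · simp only [Set.mem_ofPred_eq, hM]
    rw [div_mul_cancel₀ _ (hz i₀).ne']
  · intro i hi
    have h1 := key i
    rw [Set.mem_ofPred_eq] at hi
    have h2 : ∑ j with G.Adj i j, (|y i| + |y j|) ≤ ∑ j with G.Adj i j, M * (z i + z j) :=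
      Finset.sum_le_sum fun j _ => by rw [hi, mul_add]; linarith [hle j]
    rw [← Finset.mul_sum, hi] at *
    have h3 : M * (q G * z i) ≤ M * rowSum G z i := by
      unfold rowSum; linarith
    exact le_of_mul_le_mul_left h3 hMpos
  · intro i hi hrow j hij
    rw [Set.mem_ofPred_eq] at hi ⊢
    have h1 := key i
    have h2 : ∑ j with G.Adj i j, M * (z i + z j) ≤ ∑ j with G.Adj i j, (|y i| + |y j|) := by
      rw [← Finset.mul_sum]
      refine le_trans ?_ h1
      rw [hi]
      have := mul_le_mul_of_nonneg_left hrow hMpos.le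
      unfold rowSum at this
      linarith
    by_contra hne
    have hlt : |y j| < M * z j := lt_of_le_of_ne (hle j) hne
    refine absurd h2 (not_le.2 ?_)
    refine Finset.sum_lt_sum (fun l _ => by rw [hi, mul_add]; linarith [hle l])
      ⟨j, by simpa using hij, by rw [hi, mul_add]; linarith⟩

theorem q_eq_of_positive_eigenvector [Nonempty V] (G : SimpleGraph V) {z : V → ℝ} {c : ℝ}
    (hz : ∀ i, 0 < z i) (h : ∀ i, rowSum G z i = c * z i) : q G = c := by
  refine le_antisymm ?_ (le_q_of_eigenvector G ?_ h)
  · obtain ⟨I, ⟨i, hi⟩, h1, -⟩ := exists_rowSum_ge G hz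
    have := h1 i hi
    rw [h] at this
    exact le_of_mul_le_mul_right this (hz i)
  · obtain ⟨i⟩ := ‹Nonempty V›
    exact fun h0 => (hz i).ne' (congrFun h0 i)

theorem rowSum_comp_iso {W : Type*} [Fintype W] {G : SimpleGraph V} {H : SimpleGraph W}
    (e : G ≃g H) (z : W → ℝ) (i : V) : rowSum G (z ∘ e) i = rowSum H z (e i) := by
  classical
  unfold rowSum
  refine Finset.sum_equiv e.toEquiv (fun j => ?_) (fun j _ => rfl)
  simpa using (e.map_adj_iff (v := i) (w := j)).symm

theorem q_le_of_iso [Nonempty V] {W : Type*} [Fintype W] {G : SimpleGraph V} {H : SimpleGraph W}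
    (e : G ≃g H) : q G ≤ q H := by
  obtain ⟨y, hy0, hy⟩ := exists_eigenvector G
  refine le_q_of_eigenvector H (y := y ∘ e.symm) (fun h => hy0 ?_) (fun i => ?_)
  · ext i
    simpa using congrFun h (e i)
  · rw [rowSum_comp_iso, hy]; rfl

theorem q_congr_iso [Nonempty V] {W : Type*} [Fintype W] {G : SimpleGraph V} {H : SimpleGraph W}
    (e : G ≃g H) : q G = q H := by
  have : Nonempty W := e.toEquiv.nonempty_congr.1 ‹_›
  exact le_antisymm (q_le_of_iso e) (q_le_of_iso e.symm)

open Classical in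
/-- The bound of `q(G)` by the maximum of `d(u) + m(u)`, where `m(u)` is the average degree
of the neighbours of `u`. -/
theorem exists_q_mul_degree_le [Nonempty V] (G : SimpleGraph V) (hq : 0 < q G) :
    ∃ u, 0 < G.degree u ∧
      q G * G.degree u ≤ (G.degree u : ℝ) ^ 2 + ∑ w ∈ G.neighborFinset u, (G.degree w : ℝ) := by
  -- The degree vector is the intended weight; the maximum with 1 only keeps it positive at isolated
  -- vertices.
  have hz : ∀ i, (0 : ℝ) < max (G.degree i : ℝ) 1 := fun i => lt_max_of_lt_right one_pos
  obtain ⟨I, ⟨u, hu⟩, h1, -⟩ := exists_rowSum_ge G hz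
  have h2 := h1 u hu
  have hpos : ∀ {v w}, G.Adj v w → 0 < G.degree v := fun {v w} h =>
    (G.degree_pos_iff_exists_adj v).2 ⟨w, h⟩
  have hmax : ∀ v, 0 < G.degree v → max (G.degree v : ℝ) 1 = G.degree v := fun v hv =>
    max_eq_left (by exact_mod_cast hv)
  have hu0 : 0 < G.degree u := by
    by_contra h0
    have : rowSum G (fun i => max (G.degree i : ℝ) 1) u = 0 := by
      refine Finset.sum_eq_zero fun j hj => ?_
      simp only [mem_filter, mem_univ, true_and] at hj
      exact absurd (hpos hj) h0
    rw [this] at h2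
    have := mul_pos hq (hz u)
    linarith
  refine ⟨u, hu0, ?_⟩
  rw [hmax u hu0] at h2
  refine h2.trans (le_of_eq ?_)
  rw [rowSum, ← neighborFinset_eq_filter, Finset.sum_add_distrib, Finset.sum_const,
    card_neighborFinset_eq_degree, hmax u hu0, nsmul_eq_mul, sq]
  congr 1
  refine Finset.sum_congr rfl fun j hj => hmax j (hpos (G.mem_neighborFinset u j |>.1 hj).symm)

/-- The larger root of `X ^ 2 - (n + 2 t - 2) X + 2 t (t - 1)`. -/
noncomputable def qS (n t : ℕ) : ℝ :=
  ((n + 2 * t - 2) + √(((n : ℝ) + 2 * t - 2) ^ 2 - 8 * t * (t - 1))) / 2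

theorem qS_spec {n t : ℕ} (ht : 3 ≤ t) (hn : 8 * (t : ℝ) ^ 2 - 12 * t + 9 ≤ n) :
    qS n t * (n + 2 * t - 2 - qS n t) = 2 * t * (t - 1) ∧ (n : ℝ) + 2 * t - 3 ≤ qS n t := by
  have ht' : (3 : ℝ) ≤ t := by exact_mod_cast ht
  set D : ℝ := ((n : ℝ) + 2 * t - 2) ^ 2 - 8 * t * (t - 1) with hD
  -- The difference is 4(n + 2t - 3) - 8t(t - 1), nonnegative once n ≥ 2t² - 4t + 3.
  have hD1 : ((n : ℝ) + 2 * t - 4) ^ 2 ≤ D := by rw [hD]; nlinarith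
  have hs : √D ^ 2 = D := Real.sq_sqrt ((sq_nonneg _).trans hD1)
  have h1 : (n : ℝ) + 2 * t - 4 ≤ √D := Real.le_sqrt_of_sq_le hD1
  constructor
  · unfold qS; rw [← hD]; nlinarith
  · unfold qS; rw [← hD]; linarith

theorem S_adj {n t : ℕ} {x y : Fin t ⊕ Fin (n - t)} :
    (S n t).Adj x y ↔ x ≠ y ∧ (x.isLeft ∨ y.isLeft) := by
  rcases x with x | x <;> rcases y with y | y <;> simp [S, join, emptyGraph]

theorem q_S {n t : ℕ} (ht : 3 ≤ t) (hn : 8 * (t : ℝ) ^ 2 - 12 * t + 9 ≤ n) :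
    q (S n t) = qS n t := by
  classical
  obtain ⟨h1, h2⟩ := qS_spec ht hn
  have ht' : (3 : ℝ) ≤ t := by exact_mod_cast ht
  have htn : t ≤ n := by
    have : (t : ℝ) ≤ n := by nlinarith
    exact_mod_cast this
  have : Nonempty (Fin t ⊕ Fin (n - t)) := ⟨.inl ⟨0, by omega⟩⟩
  set Q := qS n t
  -- An independent vertex has row sum t((Q - t) + t) = Qt; at a clique vertex the eigenvalue
  -- equation is the quadratic defining Q.
  refine q_eq_of_positive_eigenvector (S n t)
    (z := Sum.elim (fun _ => Q - t) (fun _ => (t : ℝ))) ?_ ?_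
  · rintro (i | i) <;> simp only [Sum.elim_inl, Sum.elim_inr] <;> nlinarith
  · have hsplit : ∀ (i : Fin t ⊕ Fin (n - t)) (z : Fin t ⊕ Fin (n - t) → ℝ), rowSum (S n t) z i =
        (∑ j : Fin t, if (S n t).Adj i (.inl j) then z i + z (.inl j) else 0) +
        ∑ j : Fin (n - t), if (S n t).Adj i (.inr j) then z i + z (.inr j) else 0 := by
      intro i z
      rw [rowSum, Finset.sum_filter, Fintype.sum_sum_type]
    rintro (i | i)
    · rw [hsplit]
      simp only [S, join, sup_adj, Sum.elim_inl, Sum.elim_inr, SimpleGraph.sum_adj,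
        completeBipartiteGraph_adj, completeGraph, top_adj, Sum.isLeft_inl, Sum.isRight_inl,
        Sum.isRight_inr, Sum.isLeft_inr]
      simp only [Bool.false_eq_true, and_false, or_false, false_and, and_self, or_true, if_true,
        sum_const, card_univ, Fintype.card_fin, nsmul_eq_mul, Nat.cast_sub htn]
      rw [← Finset.sum_filter, Finset.sum_const, Finset.filter_ne, Finset.card_erase_of_mem
        (mem_univ _), card_univ, Fintype.card_fin, nsmul_eq_mul, Nat.cast_sub (by omega)]
      push_cast
      linarith
    · rw [hsplit]
      simp [S_adj, mul_comm]

theorem nonempty_iso_S {n t : ℕ} (G : SimpleGraph V) (hV : Fintype.card V = n) (T : Finset V)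
    (hT : #T = t) (h : ∀ v w, G.Adj v w ↔ v ≠ w ∧ (v ∈ T ∨ w ∈ T)) : Nonempty (G ≃g S n t) := by
  classical
  have e₁ : {v // v ∈ T} ≃ Fin t := Fintype.equivFinOfCardEq (by simp [hT])
  have e₂ : {v // v ∉ T} ≃ Fin (n - t) := Fintype.equivFinOfCardEq (by
    rw [Fintype.card_subtype_compl, hV]; simp [hT])
  let e : V ≃ Fin t ⊕ Fin (n - t) := (Equiv.sumCompl (· ∈ T)).symm.trans (e₁.sumCongr e₂)
  have he : ∀ v, (e v).isLeft ↔ v ∈ T := fun v => by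
    by_cases hv : v ∈ T
    · simp [e, hv, Equiv.sumCompl_symm_apply_of_pos]
    · simp [e, hv, Equiv.sumCompl_symm_apply_of_neg]
  exact ⟨⟨e, fun {v w} => by
    rw [S_adj, h, he, he, e.injective.ne_iff]⟩⟩

open Classical in
/-- A positive vector constant on `T` and off `T` certifies `q(G) ≤ q(S_{n,t})`. -/
theorem q_le_and_nonempty_iso_of_core {n t : ℕ} (ht : 3 ≤ t)
    (hn : 8 * (t : ℝ) ^ 2 - 12 * t + 9 ≤ n)
    (G : SimpleGraph V) (hV : Fintype.card V = n) (T : Finset V) (hT : #T = t) {u : V}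
    (hu : ∀ v, v ≠ u → G.Adj u v)
    (h : ∀ v ∉ T, (∀ w, G.Adj v w → w ∈ T) ∨ ((∀ w ∈ T, G.Adj v w → w = u) ∧
      2 * (t : ℝ) * #{w | G.Adj v w ∧ w ∉ T} < (t - 1) * qS n t)) (hq : qS n t ≤ q G) :
    q G ≤ qS n t ∧ Nonempty (G ≃g S n t) := by
  obtain ⟨h1, h2⟩ := qS_spec ht hn
  have ht' : (3 : ℝ) ≤ t := by exact_mod_cast ht
  set Q := qS n t
  have hQt : (t : ℝ) < Q := by nlinarith
  set z : V → ℝ := fun v => if v ∈ T then Q - t else t with hzdef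
  have hz : ∀ v, 0 < z v := fun v => by simp only [hzdef]; split_ifs <;> linarith
  have : Nonempty V := ⟨u⟩
  have hsum : ∀ v, ∑ w ∈ univ.erase v, (z v + z w) =
      (n - 2) * z v + t * (Q - t) + (n - t) * t := fun v => by
    have hc : #{w | w ∉ T} = n - t := by
      rw [Finset.filter_not, Finset.card_sdiff_of_subset (by simp), card_univ, hV]
      simp [hT]
    have htn : t ≤ n := by rw [← hV, ← hT]; exact Finset.card_le_univ T
    have hz' : ∑ w, z w = t * (Q - t) + (n - t) * t := by
      simp only [hzdef, Finset.sum_ite, Finset.sum_const, hc, nsmul_eq_mul, Nat.cast_sub htn]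
      simp [hT]
    have := Finset.add_sum_erase univ (fun w => z v + z w) (mem_univ v)
    simp only [Finset.sum_add_distrib, hz', sum_const, card_univ, hV, nsmul_eq_mul] at this ⊢
    linarith
  -- By the quadratic for Q, a vertex of T adjacent to everything has row sum exactly Q z; each
  -- missing edge loses a positive term.
  have hrowT : ∀ v ∈ T, rowSum G z v ≤ Q * z v ∧
      (Q * z v ≤ rowSum G z v → ∀ w, w ≠ v → G.Adj v w) := fun v hv => by
    have hfull : ∑ w ∈ univ.erase v, (z v + z w) = Q * z v := by
      rw [hsum]; simp only [hzdef, hv, if_true]; linarith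
    have hsub : ({w | G.Adj v w} : Finset V) ⊆ univ.erase v := fun w hw => by
      simp only [mem_filter, mem_univ, true_and] at hw
      simp [hw.ne']
    refine ⟨?_, fun hle w hw => ?_⟩
    · rw [← hfull]
      exact Finset.sum_le_sum_of_subset_of_nonneg hsub fun w _ _ => (add_pos (hz v) (hz w)).le
    · by_contra hvw
      refine absurd hle (not_le.2 ?_)
      rw [← hfull]
      exact Finset.sum_lt_sum_of_subset hsub (i := w) (by simp [hw]) (by simpa using hvw)
        (add_pos (hz v) (hz w)) fun w _ _ => (add_pos (hz v) (hz w)).le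
  have hrow : ∀ v ∉ T, rowSum G z v ≤ Q * z v ∧
      (Q * z v ≤ rowSum G z v → (∀ w, G.Adj v w ↔ w ∈ T)) := fun v hv => by
    have hzv : z v = t := by simp [hzdef, hv]
    -- Off T, a neighbour in T contributes t + (Q - t) = Q and any other neighbour 2t. The target is
    -- tQ, so the second alternative of `h` leaves at most Q + 2t · # < tQ.
    have hsplit : rowSum G z v =
        Q * #{w | G.Adj v w ∧ w ∈ T} + 2 * t * #{w | G.Adj v w ∧ w ∉ T} := by
      rw [rowSum, ← Finset.sum_filter_add_sum_filter_not _ (· ∈ T), Finset.filter_filter,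
        Finset.filter_filter, Finset.sum_congr rfl (g := fun _ => Q) (s₁ := {w | _ ∧ w ∈ T}),
        Finset.sum_congr rfl (g := fun _ => 2 * (t : ℝ)) (s₁ := {w | _ ∧ w ∉ T})]
      · simp only [sum_const, nsmul_eq_mul]; ring
      · intro w hw
        simp only [mem_filter, mem_univ, true_and] at hw
        simp [hzdef, hv, hw.2, two_mul]
      · intro w hw
        simp only [mem_filter, mem_univ, true_and] at hw
        simp [hzdef, hv, hw.2]
    rcases h v hv with h0 | ⟨h3, h4⟩
    · have hc0 : #{w | G.Adj v w ∧ w ∉ T} = 0 := by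
        rw [Finset.card_eq_zero, Finset.filter_eq_empty_iff]
        exact fun w _ hw => hw.2 (h0 w hw.1)
      have hsub : ({w | G.Adj v w ∧ w ∈ T} : Finset V) ⊆ T := fun w hw => by
        simp only [mem_filter, mem_univ, true_and] at hw
        exact hw.2
      rw [hsplit, hc0, hzv]
      simp only [Nat.cast_zero, mul_zero, add_zero]
      refine ⟨mul_le_mul_of_nonneg_left ?_ (by linarith), fun hle w => ⟨h0 w, fun hw => ?_⟩⟩
      · exact_mod_cast hT ▸ Finset.card_le_card hsub
      · have hle' := le_of_mul_le_mul_left hle (by linarith)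
        have := Finset.eq_of_subset_of_card_le hsub (by rw [hT]; exact_mod_cast hle')
        rw [← this] at hw
        simp only [mem_filter, mem_univ, true_and] at hw
        exact hw.1
    · have hc1 : #{w | G.Adj v w ∧ w ∈ T} ≤ 1 := by
        rw [← Finset.card_singleton u]
        refine Finset.card_le_card fun w hw => ?_
        simp only [mem_filter, mem_univ, true_and] at hw
        simpa using h3 w hw.2 hw.1
      have hc1' : (#{w | G.Adj v w ∧ w ∈ T} : ℝ) ≤ 1 := by exact_mod_cast hc1
      have hlt : rowSum G z v < Q * z v := by
        rw [hsplit, hzv]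
        nlinarith
      exact ⟨hlt.le, fun hle => absurd hle (not_le.2 hlt)⟩
  have hle : ∀ v, rowSum G z v ≤ Q * z v := fun v => by
    by_cases hv : v ∈ T
    exacts [(hrowT v hv).1, (hrow v hv).1]
  obtain ⟨I, ⟨i, hi⟩, hI1, hI2⟩ := exists_rowSum_ge G hz
  have hqle : q G ≤ Q := le_of_mul_le_mul_right ((hI1 i hi).trans (hle i)) (hz i)
  -- The maximizing set is closed under adjacency, and `u` is adjacent to every other vertex, so it
  -- is everything and each row is tight.
  have hI3 : ∀ i ∈ I, ∀ j, G.Adj i j → j ∈ I := fun i hi => hI2 i hi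
    ((hle i).trans (mul_le_mul_of_nonneg_right hq (hz i).le))
  have huI : u ∈ I := by
    by_cases hiu : i = u
    · exact hiu ▸ hi
    · exact hI3 i hi u (hu i hiu).symm
  have hall : ∀ v, Q * z v ≤ rowSum G z v := fun v => by
    have : v ∈ I := by
      by_cases hv : v = u
      · exact hv ▸ huI
      · exact hI3 u huI v (hu v hv)
    exact (mul_le_mul_of_nonneg_right hq (hz v).le).trans (hI1 v this)
  refine ⟨hqle, nonempty_iso_S G hV T hT fun v w => ⟨fun hvw => ⟨hvw.ne, ?_⟩, ?_⟩⟩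
  · by_cases hv : v ∈ T
    · exact .inl hv
    · exact .inr (((hrow v hv).2 (hall v) w).1 hvw)
  · rintro ⟨hne, hv | hw⟩
    · exact (hrowT v hv).2 (hall v) w hne.symm
    · exact ((hrowT w hw).2 (hall w) v hne).symm

end Spectral

/-! ### Sufficient conditions for a copy of F centred at u. -/

section Criterion

variable {V : Type*} {k : ℕ} {a : Fin k → ℕ} {G : SimpleGraph V} {u : V}

theorem F_adj_cases {x y : CycleVertex a} (h : (F a).Adj x y) :
    ∃ i, ∃ p q : Fin (2 * a i + 1), (cycleGraph (2 * a i + 1)).Adj p q ∧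
      cycleEmb a i p = x ∧ cycleEmb a i q = y := by
  simpa [F, SimpleGraph.iSup_adj, SimpleGraph.map_adj] using h

theorem not_free_of_paths (p : (i : Fin k) → ℕ → V)
    (hinj : ∀ i j x y, x < 2 * a i → y < 2 * a j → p i x = p j y → i = j ∧ x = y)
    (hu : ∀ i x, x < 2 * a i → p i x ≠ u)
    (hadj : ∀ i x, x + 1 < 2 * a i → G.Adj (p i x) (p i (x + 1)))
    (hfirst : ∀ i, 0 < a i → G.Adj u (p i 0))
    (hlast : ∀ i, 0 < a i → G.Adj u (p i (2 * a i - 1))) : ¬ (F a).Free G := by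
  rw [not_free]
  let f : CycleVertex a → V := fun x => x.elim u fun s => p s.1 s.2
  have hf : Function.Injective f := by
    rintro (_ | ⟨i, x⟩) (_ | ⟨j, y⟩) h
    · rfl
    · exact absurd h.symm (hu j y y.2)
    · exact absurd h (hu i x x.2)
    · obtain ⟨rfl, hxy⟩ := hinj i j x y x.2 y.2 h
      rw [Fin.ext hxy]
  have hval : ∀ i (x : Fin (2 * a i + 1)),
      f (cycleEmb a i x) = if (x : ℕ) = 0 then u else p i (x - 1) := by
    intro i x
    refine Fin.cases ?_ (fun y => ?_) x <;> simp [f, cycleEmb] <;> rfl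
  have key : ∀ i (x y : Fin (2 * a i + 1)), (cycleGraph (2 * a i + 1)).Adj x y → x < y →
      G.Adj (f (cycleEmb a i x)) (f (cycleEmb a i y)) := by
    intro i x y hxy hlt
    have hlt' : (x : ℕ) < y := hlt
    have hx := x.2
    have hy := y.2
    rw [cycleGraph_adj'] at hxy
    have hcase : (y : ℕ) = x + 1 ∨ ((x : ℕ) = 0 ∧ (y : ℕ) = 2 * a i) := by
      rcases hxy with h | h
      · rw [Fin.coe_sub_iff_lt.2 hlt] at h
        right; omega
      · rw [Fin.sub_val_of_le hlt.le] at h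
        left; omega
    rw [hval, hval]
    rcases hcase with h | ⟨h0, h1⟩
    · by_cases hx0 : (x : ℕ) = 0
      · rw [if_pos hx0, if_neg (by omega), h, hx0]
        exact hfirst i (by omega)
      · rw [if_neg hx0, if_neg (by omega)]
        have := hadj i (x - 1) (by omega)
        rwa [show (x : ℕ) - 1 + 1 = y - 1 by omega] at this
    · rw [if_pos h0, if_neg (by omega), h1]
      exact hlast i (by omega)
  refine ⟨⟨⟨f, fun {x y} h => ?_⟩, hf⟩⟩
  obtain ⟨i, p, q, hpq, rfl, rfl⟩ := F_adj_cases h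
  rcases lt_or_gt_of_ne hpq.ne with hlt | hlt
  · exact key i p q hpq hlt
  · exact (key i q p hpq.symm hlt).symm

/-- The total of the entries of `a` before position `i`. -/
def offset (a : Fin k → ℕ) (i : Fin k) : ℕ := ∑ j ∈ Iio i, a j

theorem offset_add_le_offset {i j : Fin k} (h : i < j) : offset a i + a i ≤ offset a j := by
  have : Iio j ⊇ insert i (Iio i) := by
    intro l hl
    simp only [mem_insert, mem_Iio] at hl ⊢
    rcases hl with rfl | hl
    exacts [h, hl.trans h]
  calc _ = ∑ l ∈ insert i (Iio i), a l := by
        rw [Finset.sum_insert (by simp), offset, add_comm]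
    _ ≤ _ := Finset.sum_le_sum_of_subset this

theorem offset_add_le_sum (i : Fin k) : offset a i + a i ≤ ∑ j, a j := by
  calc _ = ∑ l ∈ insert i (Iio i), a l := by
        rw [Finset.sum_insert (by simp), offset, add_comm]
    _ ≤ _ := Finset.sum_le_sum_of_subset (Finset.subset_univ _)

/-- The cycles, with the common vertex removed, are laid end to end on one sequence of 2t vertices:
cycle i occupies the 2a_i positions from 2 · `offset a i` on. -/
theorem not_free_of_seq {t : ℕ} (ht : t = ∑ i, a i) (c : ℕ → V)
    (hinj : ∀ x y, x < 2 * t → y < 2 * t → c x = c y → x = y)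
    (hu : ∀ x < 2 * t, c x ≠ u)
    (hadj : ∀ i x, x + 1 < 2 * a i → G.Adj (c (2 * offset a i + x)) (c (2 * offset a i + x + 1)))
    (hfirst : ∀ i, 0 < a i → G.Adj u (c (2 * offset a i)))
    (hlast : ∀ i, 0 < a i → G.Adj u (c (2 * offset a i + 2 * a i - 1))) : ¬ (F a).Free G := by
  have hle : ∀ i, offset a i + a i ≤ t := fun i => ht ▸ offset_add_le_sum i
  refine not_free_of_paths (u := u) (fun i x => c (2 * offset a i + x)) ?_ ?_ ?_ ?_ ?_
  · intro i j x y hx hy hxy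
    have h1 := hle i
    have h2 := hle j
    have h3 := hinj _ _ (by omega) (by omega) hxy
    rcases lt_trichotomy i j with h | h | h
    · have := offset_add_le_offset (a := a) h; omega
    · subst h; exact ⟨rfl, by omega⟩
    · have := offset_add_le_offset (a := a) h; omega
  · intro i x hx
    have h1 := hle i
    exact hu _ (by omega)
  · exact hadj
  · exact hfirst
  · intro i hi
    have := hlast i hi
    rwa [Nat.add_sub_assoc (by omega)] at this

theorem offset_zero (hk : 0 < k) : offset a ⟨0, hk⟩ = 0 := by
  rw [offset, Finset.sum_eq_zero]
  intro j hj
  simp [Fin.lt_def] at hj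

theorem le_offset (hk : 0 < k) {i : Fin k} (hi : i ≠ ⟨0, hk⟩) : a ⟨0, hk⟩ ≤ offset a i := by
  have h : (⟨0, hk⟩ : Fin k) < i := by
    rw [Fin.lt_def]
    exact Nat.pos_of_ne_zero fun h => hi (Fin.ext h)
  have := offset_add_le_offset (a := a) h
  omega

/-- A sequence of vertices whose entries, except possibly the one with index `1`, are neighbours
of `u`, with consecutive entries adjacent except possibly between the first cycle and the rest. -/
theorem not_free_of_seq_neighbors {t : ℕ} (ht : t = ∑ i, a i) (hk : 0 < k)
    (ha : 2 ≤ a ⟨0, hk⟩) (c : ℕ → V)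
    (hinj : ∀ x y, x < 2 * t → y < 2 * t → c x = c y → x = y)
    (hu : ∀ x < 2 * t, x ≠ 1 → G.Adj u (c x)) (hu1 : c 1 ≠ u)
    (hadj : ∀ x, x + 1 < 2 * t → x + 1 ≠ 2 * a ⟨0, hk⟩ → G.Adj (c x) (c (x + 1))) :
    ¬ (F a).Free G := by
  have hle : ∀ i, offset a i + a i ≤ t := fun i => ht ▸ offset_add_le_sum i
  refine not_free_of_seq (u := u) ht c hinj ?_ ?_ ?_ ?_
  · intro x hx
    by_cases h : x = 1
    · rwa [h]
    · exact (hu x hx h).ne'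
  · intro i x hx
    have := hle i
    refine hadj _ (by omega) ?_
    by_cases hi : i = ⟨0, hk⟩
    · subst hi; rw [offset_zero]; omega
    · have := le_offset (a := a) hk hi; omega
  · intro i hi
    have := hle i
    exact hu _ (by omega) (by omega)
  · intro i hi
    have := hle i
    refine hu _ (by omega) ?_
    by_cases hi : i = ⟨0, hk⟩
    · subst hi; rw [offset_zero]; omega
    · have := le_offset (a := a) hk hi; omega

/-- A path on `2 t - 1` neighbours of `u` and `t` further vertices adjacent to all of them. -/
theorem not_free_of_path_of_complete {t : ℕ} (ht : t = ∑ i, a i) (hk : 0 < k)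
    (ha : 2 ≤ a ⟨0, hk⟩) (c w : ℕ → V)
    (hinj : ∀ x y, x < 2 * t - 1 → y < 2 * t - 1 → c x = c y → x = y)
    (hu : ∀ x < 2 * t - 1, G.Adj u (c x))
    (hadj : ∀ x, x + 1 < 2 * t - 1 → G.Adj (c x) (c (x + 1)))
    (hwinj : ∀ x y, x < t → y < t → w x = w y → x = y)
    (hwu : ∀ x < t, w x ≠ u ∧ ¬ G.Adj u (w x))
    (hw : ∀ x y, x < 2 * t - 1 → y < t → G.Adj (c x) (w y)) : ¬ (F a).Free G := by
  classical
  have hle : ∀ i, offset a i + a i ≤ t := fun i => ht ▸ offset_add_le_sum i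
  have h0 := hle ⟨0, hk⟩
  /- odd positions and first positions of the cycles carry neighbours of `u` -/
  let st : ℕ → Prop := fun x => x % 2 = 1 ∨ ∃ i, 0 < a i ∧ x = 2 * offset a i
  -- Position 2 never carries a path vertex, as the first cycle has a ≥ 2, so the 2t - 1 path
  -- vertices suffice for the other positions. Position 3 takes the last one; when a later cycle
  -- starts at p, positions p and p + 1 still receive consecutive path vertices.
  let m' : ℕ → ℕ := fun x => if x < 2 then x else if x = 3 then 2 * t - 2 else x - 2
  let d : ℕ → V := fun x => if st x then c (m' x) else w (x / 2)
  have hst2 : ¬ st 2 := by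
    rintro (h | ⟨i, hi, h⟩)
    · omega
    · by_cases hi' : i = ⟨0, hk⟩
      · subst hi'; rw [offset_zero] at h; omega
      · have := le_offset (a := a) hk hi'; omega
  have hm' : ∀ x, x < 2 * t → st x → m' x < 2 * t - 1 := fun x hx _ => by
    simp only [m']; split_ifs <;> omega
  have hmm : ∀ x y, x < 2 * t → y < 2 * t → st x → st y → m' x = m' y → x = y := by
    intro x y hx hy hsx hsy h
    have hx2 : x ≠ 2 := fun h => hst2 (h ▸ hsx)
    have hy2 : y ≠ 2 := fun h => hst2 (h ▸ hsy)
    simp only [m'] at h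
    split_ifs at h <;> omega
  have hwc : ∀ x y, x < t → y < 2 * t - 1 → w x ≠ c y := fun x y hx hy h =>
    (hwu x hx).2 (h ▸ hu y hy)
  have hst_odd : ∀ x, x % 2 = 1 → st x := fun x h => .inl h
  have hd : ∀ x, st x → d x = c (m' x) := fun x hx => if_pos hx
  have hd' : ∀ x, ¬ st x → d x = w (x / 2) := fun x hx => if_neg hx
  have hst_first : ∀ i, 0 < a i → st (2 * offset a i) := fun i hi => .inr ⟨i, hi, rfl⟩
  refine not_free_of_seq (u := u) ht d ?_ ?_ ?_ ?_ ?_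
  · intro x y hx hy hxy
    by_cases hsx : st x <;> by_cases hsy : st y
    · rw [hd x hsx, hd y hsy] at hxy
      exact hmm x y hx hy hsx hsy (hinj _ _ (hm' x hx hsx) (hm' y hy hsy) hxy)
    · rw [hd x hsx, hd' y hsy] at hxy
      exact absurd hxy.symm (hwc _ _ (by omega) (hm' x hx hsx))
    · rw [hd' x hsx, hd y hsy] at hxy
      exact absurd hxy (hwc _ _ (by omega) (hm' y hy hsy))
    · rw [hd' x hsx, hd' y hsy] at hxy
      have h1 := hwinj _ _ (by omega) (by omega) hxy
      have h2 : x % 2 ≠ 1 := fun h => hsx (hst_odd x h)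
      have h3 : y % 2 ≠ 1 := fun h => hsy (hst_odd y h)
      omega
  · intro x hx
    by_cases hsx : st x
    · rw [hd x hsx]; exact (hu _ (hm' x hx hsx)).ne'
    · rw [hd' x hsx]; exact (hwu _ (by omega)).1
  · intro i x hx
    have hi := hle i
    set p := 2 * offset a i + x with hp
    rcases Nat.mod_two_eq_zero_or_one x with hx2 | hx2
    · have h1 : st (p + 1) := hst_odd _ (by omega)
      rw [hd _ h1]
      by_cases hsp : st p
      · have hp2 : p ≠ 2 := fun h => hst2 (h ▸ hsp)
        have h2 : m' (p + 1) = m' p + 1 := by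
          simp only [m']; split_ifs <;> omega
        rw [hd _ hsp, h2]
        exact hadj _ (by have := hm' (p + 1) (by omega) h1; omega)
      · rw [hd' _ hsp]
        exact (hw _ _ (hm' _ (by omega) h1) (by omega)).symm
    · have h1 : st p := hst_odd _ (by omega)
      have h2 : ¬ st (p + 1) := by
        rintro (h | ⟨j, hj, h⟩)
        · omega
        · rcases lt_trichotomy i j with h' | h' | h'
          · have := offset_add_le_offset (a := a) h'; omega
          · subst h'; omega
          · have := offset_add_le_offset (a := a) h'; omega
      rw [hd _ h1, hd' _ h2]
      exact hw _ _ (hm' _ (by omega) h1) (by omega)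
  · intro i hi
    have := hle i
    rw [hd _ (hst_first i hi)]
    exact hu _ (hm' _ (by omega) (hst_first i hi))
  · intro i hi
    have := hle i
    have h1 : st (2 * offset a i + 2 * a i - 1) := hst_odd _ (by omega)
    rw [hd _ h1]
    exact hu _ (hm' _ (by omega) h1)

end Criterion

/-! ### Paths and cycles as lists; rotations and crossing chords. -/

section Paths

variable {α : Type*} {K : SimpleGraph α}

/-- A list of distinct vertices with consecutive entries adjacent. -/
def IsPathList (K : SimpleGraph α) (l : List α) : Prop := l.IsChain K.Adj ∧ l.Nodup

/-- A list of distinct vertices with cyclically consecutive entries adjacent. -/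
def IsCycleList (K : SimpleGraph α) (l : List α) : Prop :=
  IsPathList K l ∧ ∀ x ∈ l.getLast?, ∀ y ∈ l.head?, K.Adj x y

theorem isPathList_append {l₁ l₂ : List α} : IsPathList K (l₁ ++ l₂) ↔
    IsPathList K l₁ ∧ IsPathList K l₂ ∧ l₁.Disjoint l₂ ∧
      ∀ x ∈ l₁.getLast?, ∀ y ∈ l₂.head?, K.Adj x y := by
  unfold IsPathList
  rw [List.isChain_append, List.nodup_append']
  tauto

theorem isPathList_cons {x : α} {l : List α} : IsPathList K (x :: l) ↔
    x ∉ l ∧ (∀ y ∈ l.head?, K.Adj x y) ∧ IsPathList K l := by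
  unfold IsPathList
  rw [List.isChain_cons, List.nodup_cons]
  tauto

theorem isPathList_reverse {l : List α} : IsPathList K l.reverse ↔ IsPathList K l := by
  unfold IsPathList
  rw [List.isChain_reverse, List.nodup_reverse]
  simp only [K.adj_comm]

theorem IsCycleList.rotate {l₁ l₂ : List α} (h : IsCycleList K (l₁ ++ l₂)) :
    IsCycleList K (l₂ ++ l₁) := by
  rcases l₁.eq_nil_or_concat with rfl | ⟨l₁', x, rfl⟩
  · simpa using h
  rcases l₂ with _ | ⟨y, l₂⟩
  · simpa using h
  obtain ⟨h1, h2⟩ := h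
  rw [isPathList_append] at h1
  obtain ⟨h1, h3, h4, h5⟩ := h1
  refine ⟨isPathList_append.2 ⟨h3, h1, h4.symm, ?_⟩, ?_⟩
  · intro a ha b hb
    refine h2 a ?_ b ?_
    · rw [List.getLast?_append_of_ne_nil _ (by simp)]; exact ha
    · rw [List.head?_append_of_ne_nil _ (by simp)]; exact hb
  · intro a ha b hb
    refine h5 a ?_ b ?_
    · rwa [List.getLast?_append_of_ne_nil _ (by simp)] at ha
    · rwa [List.head?_append_of_ne_nil _ (by simp)] at hb

theorem exists_adj_of_mem_of_notMem (hK : K.Preconnected) {s : Set α} {x y : α} (hx : x ∈ s)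
    (hy : y ∉ s) : ∃ a ∈ s, ∃ b ∉ s, K.Adj a b := by
  obtain ⟨p⟩ := hK x y
  obtain ⟨d, -, h1, h2⟩ := p.exists_boundary_dart s hx hy
  exact ⟨d.fst, h1, d.snd, h2, d.adj⟩

/-- In a connected graph, a cycle that misses a vertex can be opened to a longer path. -/
theorem IsCycleList.exists_longer_path (hK : K.Preconnected) {c : List α} (hc : IsCycleList K c)
    (hne : c ≠ []) {z : α} (hz : z ∉ c) :
    ∃ l, IsPathList K l ∧ l.length = c.length + 1 := by
  obtain ⟨x, hx⟩ := List.exists_mem_of_ne_nil c hne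
  obtain ⟨a, ha, b, hb, hab⟩ :=
    exists_adj_of_mem_of_notMem hK (s := {v | v ∈ c}) (x := x) (y := z) hx hz
  obtain ⟨l₁, l₂, rfl⟩ := List.append_of_mem (show a ∈ c from ha)
  have hb' : b ∉ l₁ ++ a :: l₂ := hb
  refine ⟨b :: ((a :: l₂) ++ l₁), isPathList_cons.2 ⟨?_, ?_, hc.rotate.1⟩, ?_⟩
  · simp only [List.mem_append, List.mem_cons] at hb' ⊢; tauto
  · simpa using hab.symm
  · simp; omega

theorem mem_of_adj_head {x : α} {l : List α} (hp : IsPathList K (x :: l))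
    (hmax : ∀ l', IsPathList K l' → l'.length ≤ l.length + 1) {y : α} (h : K.Adj x y) :
    y ∈ l := by
  by_contra hy
  have := hmax (y :: x :: l) (isPathList_cons.2 ⟨?_, ?_, hp⟩)
  · simp at this
  · simpa [hy] using h.ne'
  · simpa using h.symm

/-- The path obtained by reversing the beginning of a path up to a neighbour of its first
vertex. -/
theorem isPathList_rotation {p : List α} (hp : IsPathList K p) {i : ℕ} (hi : i + 1 < p.length)
    (h1 : K.Adj p[0] p[i + 1]) : IsPathList K ((p.take (i + 1)).reverse ++ p.drop (i + 1)) := by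
  have h := hp
  rw [← List.take_append_drop (i + 1) p, isPathList_append] at h
  refine isPathList_append.2 ⟨isPathList_reverse.2 h.1, h.2.1, ?_, ?_⟩
  · intro x hx
    exact h.2.2.1 (by simpa using hx)
  · intro x hx y hy
    rw [List.getLast?_reverse, List.head?_take, if_neg (by omega), List.head?_eq_getElem?,
      List.getElem?_eq_getElem (by omega), Option.mem_some_iff] at hx
    rw [List.head?_drop, List.getElem?_eq_getElem hi, Option.mem_some_iff] at hy
    exact hx ▸ hy ▸ h1

/-- Crossing chords from the ends of a path close it to a cycle. -/
theorem isCycleList_of_crossing {p : List α} (hp : IsPathList K p) {i : ℕ} (hi : i + 1 < p.length)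
    (h1 : K.Adj p[0] p[i + 1]) (h2 : K.Adj p[p.length - 1] p[i]) :
    IsCycleList K ((p.take (i + 1)).reverse ++ p.drop (i + 1)) := by
  refine ⟨isPathList_rotation hp hi h1, fun x hx y hy => ?_⟩
  rw [List.getLast?_append_of_ne_nil _ (List.ne_nil_of_length_pos (by simp; omega)),
    List.getLast?_drop, if_neg (by omega), List.getLast?_eq_getElem?,
    List.getElem?_eq_getElem (by omega), Option.mem_some_iff] at hx
  rw [List.head?_append_of_ne_nil _ (List.ne_nil_of_length_pos (by simp; omega)),
    List.head?_reverse, List.getLast?_take, if_neg (by omega), Nat.add_sub_cancel,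
    List.getElem?_eq_getElem (by omega), Option.some_or, Option.mem_some_iff] at hy
  exact hx ▸ hy ▸ h2

variable [Fintype α]

open Classical in
theorem degree_le_of_neighbors {v : α} {s : Finset α} (h : ∀ w, K.Adj v w → w ∈ s) :
    K.degree v ≤ #s := by
  rw [← card_neighborFinset_eq_degree]
  exact Finset.card_le_card fun w hw => h w (by simpa using hw)

theorem exists_longest_path [Nonempty α] : ∃ p, IsPathList K p ∧ p ≠ [] ∧
    ∀ l, IsPathList K l → l.length ≤ p.length := by
  classical
  let P : ℕ → Prop := fun n => ∃ l, IsPathList K l ∧ l.length = n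
  have hb : ∀ n, P n → n ≤ Fintype.card α := by
    rintro n ⟨l, hl, rfl⟩
    exact hl.2.length_le_card
  obtain ⟨x⟩ := ‹Nonempty α›
  have h1 : P 1 := ⟨[x], ⟨by simp, by simp⟩, rfl⟩
  obtain ⟨p, hp, hpl⟩ := Nat.findGreatest_spec (P := P) (hb 1 h1) h1
  have hmax : ∀ l, IsPathList K l → l.length ≤ p.length := fun l hl => by
    rw [hpl]
    exact Nat.le_findGreatest (hb _ ⟨l, hl, rfl⟩) ⟨l, hl, rfl⟩
  refine ⟨p, hp, fun h => ?_, hmax⟩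
  have := hmax [x] ⟨by simp, by simp⟩
  simp [h] at this

open Classical in
/-- The indices of the chords at the two ends of a longest path that cannot be closed. -/
theorem chord_indices {p : List α} (hp : IsPathList K p)
    (hmax : ∀ l, IsPathList K l → l.length ≤ p.length) (hne : 0 < p.length)
    (hcyc : ∀ c, IsCycleList K c → c.length ≠ p.length) :
    ∃ X Y : Finset ℕ, (∀ i, i ∈ X ↔ ∃ h : i + 1 < p.length, K.Adj p[0] p[i + 1]) ∧
      (∀ i, i ∈ Y ↔ ∃ h : i + 1 < p.length, K.Adj p[p.length - 1] p[i]) ∧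
      X ⊆ range (p.length - 1) ∧ Y ⊆ range (p.length - 1) ∧ Disjoint X Y ∧
      K.degree p[0] ≤ #X ∧ K.degree p[p.length - 1] ≤ #Y := by
  let X : Finset ℕ := {i ∈ range (p.length - 1) | ∃ h : i + 1 < p.length, K.Adj p[0] p[i + 1]}
  let Y : Finset ℕ := {i ∈ range (p.length - 1) |
    ∃ h : i + 1 < p.length, K.Adj p[p.length - 1] p[i]}
  have hX : ∀ i, i ∈ X ↔ ∃ h : i + 1 < p.length, K.Adj p[0] p[i + 1] := fun i => by
    simp only [X, mem_filter, Finset.mem_range, and_iff_right_iff_imp]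
    rintro ⟨h, -⟩; omega
  have hY : ∀ i, i ∈ Y ↔ ∃ h : i + 1 < p.length, K.Adj p[p.length - 1] p[i] := fun i => by
    simp only [Y, mem_filter, Finset.mem_range, and_iff_right_iff_imp]
    rintro ⟨h, -⟩; omega
  refine ⟨X, Y, hX, hY, Finset.filter_subset _ _, Finset.filter_subset _ _, ?_, ?_, ?_⟩
  -- A common index is a pair of crossing chords, which would close the path to a cycle of the same
  -- length.
  · rw [Finset.disjoint_left]
    intro i hi hi'
    obtain ⟨h, h1⟩ := (hX i).1 hi
    obtain ⟨h', h2⟩ := (hY i).1 hi'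
    refine hcyc _ (isCycleList_of_crossing hp h h1 h2) ?_
    simp; omega
  -- By maximality all neighbours of an end lie on the path, so chord indices account for its whole
  -- degree.
  · refine (degree_le_of_neighbors (s := X.image fun i => p.getD (i + 1) p[0]) ?_).trans
      Finset.card_image_le
    intro w hw
    obtain ⟨x, l, rfl⟩ := List.exists_cons_of_length_pos hne
    have hwl := mem_of_adj_head hp (by simpa using hmax) (by simpa using hw)
    obtain ⟨i, hi, rfl⟩ := List.getElem_of_mem hwl
    exact Finset.mem_image.2 ⟨i, (hX i).2 ⟨by simpa using hi, by simpa using hw⟩, by simp [hi]⟩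
  · refine (degree_le_of_neighbors (s := Y.image fun i => p.getD i p[0]) ?_).trans
      Finset.card_image_le
    intro w hw
    rcases p.eq_nil_or_concat with rfl | ⟨l, x, rfl⟩
    · simp at hne
    have hp' : IsPathList K (x :: l.reverse) := by
      have := isPathList_reverse.2 hp
      simpa using this
    have hwl := mem_of_adj_head hp' (by simpa using hmax) (by simpa using hw)
    rw [List.mem_reverse] at hwl
    obtain ⟨i, hi, rfl⟩ := List.getElem_of_mem hwl
    refine Finset.mem_image.2 ⟨i, (hY i).2 ⟨by simpa using hi, ?_⟩, ?_⟩
    · simpa [hi, List.getElem_append_left] using hw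
    · simp [List.getD_eq_getElem?_getD, List.getElem?_append_left, hi]

end Paths

/-! ### A cycle of length 2m and a vertex off it whose neighbours all lie on it. -/

section Alternating

variable {α : Type*} {K : SimpleGraph α}

theorem IsCycleList.insert {l₁ l₂ : List α} {a b y : α} (hc : IsCycleList K (l₁ ++ a :: b :: l₂))
    (hy : y ∉ l₁ ++ a :: b :: l₂) (ha : K.Adj y a) (hb : K.Adj y b) :
    IsCycleList K (l₁ ++ a :: y :: b :: l₂) := by
  have h : IsCycleList K ((b :: l₂) ++ (l₁ ++ [a])) := by
    apply IsCycleList.rotate; simpa using hc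
  have h' : IsCycleList K ((y :: b :: l₂) ++ (l₁ ++ [a])) := by
    refine ⟨?_, ?_⟩
    · rw [List.cons_append, isPathList_cons]
      refine ⟨?_, by simpa using hb, h.1⟩
      simp only [List.mem_append, List.mem_cons, List.not_mem_nil, or_false] at hy ⊢
      tauto
    · intro x hx z hz
      rw [← List.append_assoc, List.getLast?_append_of_ne_nil _ (by simp)] at hx
      simp only [List.getLast?_singleton, Option.mem_some_iff] at hx
      simp only [List.cons_append, List.head?_cons, Option.mem_some_iff] at hz
      exact hx ▸ hz ▸ ha.symm
  simpa using h'.rotate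

variable [Fintype α]

open Classical in
/-- A vertex off a cycle of length `2 m`, with at least `m` neighbours all of them on the cycle,
is adjacent to every other vertex of the cycle, unless there is a cycle of length `2 m + 1`. -/
theorem IsCycleList.adj_iff_odd {m : ℕ} {C : List α} (hc : IsCycleList K C)
    (hlen : C.length = 2 * m) (hcyc : ∀ C, IsCycleList K C → C.length ≠ 2 * m + 1) {y : α}
    (hy : y ∉ C) (hN : ∀ z, K.Adj y z → z ∈ C) (hdeg : m ≤ K.degree y)
    (h0 : ∀ z ∈ C.head?, ¬ K.Adj y z) :
    K.degree y = m ∧ ∀ i (h : i < C.length), K.Adj y C[i] ↔ i % 2 = 1 := by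
  have hcons : ∀ i (h : i + 1 < C.length), K.Adj y C[i] → ¬ K.Adj y C[i + 1] := by
    intro i h h1 h2
    have hsplit : C = C.take i ++ C[i] :: C[i + 1] :: C.drop (i + 2) := by
      rw [List.getElem_cons_drop, List.getElem_cons_drop, List.take_append_drop]
    refine hcyc _ (IsCycleList.insert (y := y) (hsplit ▸ hc) (hsplit ▸ hy) h1 h2) ?_
    have := congrArg List.length hsplit
    simp only [List.length_append, List.length_cons] at this ⊢
    omega
  let I : Finset ℕ := {i ∈ range (2 * m) | ∃ h : i < C.length, K.Adj y C[i]}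
  have hI : ∀ i, i ∈ I ↔ ∃ h : i < C.length, K.Adj y C[i] := fun i => by
    simp only [I, mem_filter, Finset.mem_range, and_iff_right_iff_imp]
    rintro ⟨h, -⟩; omega
  have hdegI : K.degree y ≤ #I := by
    refine (degree_le_of_neighbors (s := I.image fun i => C.getD i y) ?_).trans
      Finset.card_image_le
    intro w hw
    obtain ⟨i, hi, rfl⟩ := List.getElem_of_mem (hN w hw)
    exact Finset.mem_image.2 ⟨i, (hI i).2 ⟨hi, hw⟩, by simp [hi]⟩
  -- Each of the m blocks {2j, 2j + 1} contains at most one neighbour of `y`; having at least m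
  -- neighbours, `y` has exactly one in each. As position 0 is not a neighbour, induction selects
  -- the odd position of every block.
  have hinj : Set.InjOn (fun i => i / 2) (I : Set ℕ) := by
    intro i hi j hj hij
    obtain ⟨hi1, hi2⟩ := (hI i).1 hi
    obtain ⟨hj1, hj2⟩ := (hI j).1 hj
    have hij' : i / 2 = j / 2 := hij
    rcases lt_trichotomy i j with h | h | h
    · obtain rfl : j = i + 1 := by omega
      exact absurd hj2 (hcons i hj1 hi2)
    · exact h
    · obtain rfl : i = j + 1 := by omega
      exact absurd hi2 (hcons j hi1 hj2)
  have hsub : I.image (fun i => i / 2) ⊆ range m := by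
    intro j hj
    obtain ⟨i, hi, rfl⟩ := Finset.mem_image.1 hj
    obtain ⟨hi1, -⟩ := (hI i).1 hi
    simp only [Finset.mem_range]; omega
  have hcard : #(I.image fun i => i / 2) = #I := Finset.card_image_of_injOn hinj
  have hle := Finset.card_le_card hsub
  rw [Finset.card_range, hcard] at hle
  have heq : I.image (fun i => i / 2) = range m :=
    Finset.eq_of_subset_of_card_le hsub (by rw [Finset.card_range, hcard]; omega)
  have hpair : ∀ j < m, 2 * j ∈ I ∨ 2 * j + 1 ∈ I := by
    intro j hj
    have : j ∈ I.image (fun i => i / 2) := heq ▸ Finset.mem_range.2 hj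
    obtain ⟨i, hi, hij⟩ := Finset.mem_image.1 this
    rcases Nat.mod_two_eq_zero_or_one i with h | h
    · left; rwa [show 2 * j = i by omega]
    · right; rwa [show 2 * j + 1 = i by omega]
  have heven : ∀ j < m, 2 * j ∉ I := by
    intro j
    induction j with
    | zero =>
      intro _ h
      obtain ⟨h1, h2⟩ := (hI _).1 h
      refine h0 C[0] ?_ h2
      rw [List.head?_eq_getElem?, List.getElem?_eq_getElem (by omega), Option.mem_some_iff]
    | succ j ih =>
      intro hj h
      have h1 := (hpair j (by omega)).resolve_left (ih (by omega))
      obtain ⟨h2, h3⟩ := (hI _).1 h1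
      obtain ⟨h4, h5⟩ := (hI _).1 h
      exact hcons (2 * j + 1) h4 h3 h5
  refine ⟨by omega, fun i hi => ⟨fun h => ?_, fun h => ?_⟩⟩
  · by_contra hodd
    have := heven (i / 2) (by omega)
    rw [show 2 * (i / 2) = i by omega] at this
    exact this ((hI i).2 ⟨hi, h⟩)
  · have := (hpair (i / 2) (by omega)).resolve_left (heven _ (by omega))
    rw [show 2 * (i / 2) + 1 = i by omega] at this
    obtain ⟨h', h1⟩ := (hI i).1 this
    exact h1

-- Start the cycle at `b`. Then `x` is adjacent to the odd positions, in particular to both cycle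
-- neighbours of `b`, so it can replace `b`. The new cycle misses `b`, and the path from `b` around
-- to `x` has maximal length, so `b` has all its neighbours on the new cycle. Thus
-- `IsCycleList.adj_iff_odd` applies to `b` as well and yields the same odd positions.
open Classical in
theorem IsCycleList.adj_iff_adj {m : ℕ} {c : List α} (hc : IsCycleList K c)
    (hlen : c.length = 2 * m) (hcyc : ∀ c, IsCycleList K c → c.length ≠ 2 * m + 1)
    (hmax : ∀ l, IsPathList K l → l.length ≤ 2 * m + 1) (hdeg : ∀ v, m ≤ K.degree v) {x : α}
    (hx : x ∉ c) (hN : ∀ z, K.Adj x z → z ∈ c) {b : α} (hb : b ∈ c) (hxb : ¬ K.Adj x b) :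
    K.degree x = m ∧ ∀ z, K.Adj b z ↔ K.Adj x z := by
  obtain ⟨l₁, l₂, rfl⟩ := List.append_of_mem hb
  set r := l₂ ++ l₁ with hr
  have hmem : ∀ z, z ∈ l₁ ++ b :: l₂ ↔ z ∈ b :: r := fun z => by
    simp only [hr, List.mem_append, List.mem_cons]; tauto
  have hc' : IsCycleList K (b :: r) := hc.rotate
  have hlen' : r.length + 1 = 2 * m := by
    rw [← hlen, hr]; simp only [List.length_append, List.length_cons]; omega
  simp only [hmem] at hx hN
  clear_value r
  clear hlen hc hb hmem
  obtain ⟨hdx, hodd⟩ := hc'.adj_iff_odd (by simpa using hlen') hcyc hx hN (hdeg x)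
    (by simpa using hxb)
  have hr0 : r ≠ [] := by rintro rfl; simp at hlen'; omega
  have hxr : x ∉ r := fun h => hx (List.mem_cons_of_mem _ h)
  obtain ⟨hbr, -, hpr⟩ := isPathList_cons.1 hc'.1
  have hbx : b ≠ x := fun h => hx (h ▸ List.mem_cons_self)
  have hxhead : ∀ z ∈ r.head?, K.Adj x z := fun z hz => by
    rw [List.head?_eq_getElem?, List.getElem?_eq_getElem (by omega), Option.mem_some_iff] at hz
    have := (hodd 1 (by simp; omega)).2 rfl
    rw [List.getElem_cons_succ] at this
    exact hz ▸ this
  have hxlast : ∀ z ∈ r.getLast?, K.Adj z x := fun z hz => by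
    rw [List.getLast?_eq_getElem?, List.getElem?_eq_getElem (by omega), Option.mem_some_iff] at hz
    have := (hodd (r.length - 1 + 1) (by simp; omega)).2 (by omega)
    rw [List.getElem_cons_succ] at this
    exact hz ▸ this.symm
  have hc'' : IsCycleList K (x :: r) := by
    refine ⟨isPathList_cons.2 ⟨hxr, hxhead, hpr⟩, fun z hz y hy => ?_⟩
    rw [← List.singleton_append, List.getLast?_append_of_ne_nil _ hr0] at hz
    simp only [List.head?_cons, Option.mem_some_iff] at hy
    exact hy ▸ hxlast z hz
  have hpath : IsPathList K (b :: (r ++ [x])) := by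
    rw [← List.cons_append, isPathList_append]
    refine ⟨hc'.1, ⟨by simp, by simp⟩, by simpa [hbx.symm] using hxr, fun z hz y hy => ?_⟩
    rw [← List.singleton_append, List.getLast?_append_of_ne_nil _ hr0] at hz
    simp only [List.head?_cons, Option.mem_some_iff] at hy
    exact hy ▸ hxlast z hz
  have hNb : ∀ z, K.Adj b z → z ∈ x :: r := fun z hz => by
    have := mem_of_adj_head hpath (by simp; intro l hl; have := hmax l hl; omega) hz
    simp only [List.mem_append, List.mem_cons, List.not_mem_nil, or_false] at this ⊢
    tauto
  obtain ⟨-, hodd'⟩ := hc''.adj_iff_odd (y := b) (by simpa using hlen') hcyc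
    (by simp [hbx, hbr]) hNb (hdeg b) (by simpa [K.adj_comm] using hxb)
  refine ⟨hdx, fun z => ⟨fun hz => ?_, fun hz => ?_⟩⟩
  · obtain ⟨i, hi, rfl⟩ := List.getElem_of_mem (hNb z hz)
    have h1 := (hodd' i hi).1 hz
    obtain ⟨j, rfl⟩ : ∃ j, i = j + 1 := ⟨i - 1, by omega⟩
    have := (hodd (j + 1) (by simpa using hi)).2 h1
    simpa using this
  · obtain ⟨i, hi, rfl⟩ := List.getElem_of_mem (hN z hz)
    have h1 := (hodd i hi).1 hz
    obtain ⟨j, rfl⟩ : ∃ j, i = j + 1 := ⟨i - 1, by omega⟩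
    have := (hodd' (j + 1) (by simpa using hi)).2 h1
    simpa using this

-- The core is the neighbourhood of `x`. Nonneighbours of `x` on the cycle have this neighbourhood
-- by the exchange in `IsCycleList.adj_iff_adj`. If a nonneighbour off the cycle had a neighbour
-- outside N(x), connectivity would attach two extra vertices in a row to the cycle, giving a path
-- on 2m + 2 vertices; otherwise minimum degree m forces equality of neighbourhoods.
open Classical in
theorem exists_core_of_cycle (hK : K.Preconnected) {m : ℕ} (hm : 1 ≤ m) {c : List α}
    (hc : IsCycleList K c) (hlen : c.length = 2 * m)
    (hcyc : ∀ c, IsCycleList K c → c.length ≠ 2 * m + 1)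
    (hmax : ∀ l, IsPathList K l → l.length ≤ 2 * m + 1) (hdeg : ∀ v, m ≤ K.degree v) {x : α}
    (hx : x ∉ c) (hN : ∀ z, K.Adj x z → z ∈ c) :
    ∃ A : Finset α, #A = m ∧ ∀ v ∉ A, ∀ w, K.Adj v w ↔ w ∈ A := by
  obtain ⟨b, hb, hxb⟩ : ∃ b ∈ c, ¬ K.Adj x b := by
    by_contra! hall
    obtain ⟨c₀, c₁, l, rfl⟩ : ∃ c₀ c₁ l, c = c₀ :: c₁ :: l := by
      rcases c with _ | ⟨c₀, _ | ⟨c₁, l⟩⟩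
      · simp at hlen; omega
      · simp at hlen; omega
      · exact ⟨_, _, _, rfl⟩
    refine hcyc _ (IsCycleList.insert (l₁ := []) hc hx (hall c₀ (by simp)) (hall c₁ (by simp))) ?_
    simp at hlen ⊢; omega
  have hmem : ∀ w, w ∈ K.neighborFinset x ↔ K.Adj x w := fun w => K.mem_neighborFinset x w
  have hcore : ∀ v ∈ c, ¬ K.Adj x v → ∀ w, K.Adj v w ↔ K.Adj x w := fun v hv hxv =>
    (hc.adj_iff_adj hlen hcyc hmax hdeg hx hN hv hxv).2
  have hdx := (hc.adj_iff_adj hlen hcyc hmax hdeg hx hN hb hxb).1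
  have hZ : ∀ z w, ¬ K.Adj x z → z ∉ c → K.Adj z w → K.Adj x w := by
    by_contra! hZ
    obtain ⟨z₀, w₀, h1, h2, h3, h4⟩ := hZ
    have hout : ∀ z w, z ∉ c → K.Adj z w → ¬ K.Adj x w → w ∉ c := fun z w hz hzw hxw hw =>
      hz (hN z ((hcore w hw hxw z).1 hzw.symm))
    -- An edge `z₁ y` leaving the set of bad vertices: `y` must be adjacent to `x`, hence on the
    -- cycle, and `z₂ z₁ y` continued around the cycle is too long.
    obtain ⟨z₁, ⟨hz1, hz2, z₂, hz3, hz4⟩, y, hy, hadj⟩ := exists_adj_of_mem_of_notMem hK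
      (s := {z | ¬ K.Adj x z ∧ z ∉ c ∧ ∃ w, K.Adj z w ∧ ¬ K.Adj x w}) (x := z₀) (y := b)
      ⟨h1, h2, w₀, h3, h4⟩ (fun h => h.2.1 hb)
    by_cases hxy : K.Adj x y
    · have hyc := hN y hxy
      obtain ⟨l₁, l₂, rfl⟩ := List.append_of_mem hyc
      have hz2c := hout z₁ z₂ hz2 hz3 hz4
      have hp : IsPathList K (z₂ :: z₁ :: ((y :: l₂) ++ l₁)) := by
        refine isPathList_cons.2 ⟨?_, by simpa using hz3.symm, isPathList_cons.2
          ⟨?_, by simpa using hadj, hc.rotate.1⟩⟩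
        · have := hz3.ne'
          simp only [List.mem_append, List.mem_cons] at hz2c ⊢; tauto
        · simp only [List.mem_append, List.mem_cons] at hz2 ⊢; tauto
      have := hmax _ hp
      simp only [List.length_append, List.length_cons] at this hlen
      omega
    · exact hy ⟨hxy, hout z₁ y hz2 hadj hxy, z₁, hadj.symm, hz1⟩
  refine ⟨K.neighborFinset x, by simpa using hdx, fun v hv w => ?_⟩
  rw [hmem] at hv ⊢
  by_cases hvc : v ∈ c
  · exact hcore v hvc hv w
  · refine ⟨hZ v w hv hvc, fun hw => ?_⟩
    have hsub : K.neighborFinset v ⊆ K.neighborFinset x := fun w hw => by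
      rw [mem_neighborFinset] at hw ⊢
      exact hZ v w hv hvc hw
    have := Finset.eq_of_subset_of_card_le hsub (by
      rw [card_neighborFinset_eq_degree, card_neighborFinset_eq_degree, hdx]; exact hdeg v)
    rw [← mem_neighborFinset, this]
    simpa using hw

/-- The number of ordered pairs of adjacent vertices at least one of which is in `S`. -/
noncomputable def incidentPairs (K : SimpleGraph α) (S : Finset α) : ℕ :=
  open Classical in #{p : α × α | K.Adj p.1 p.2 ∧ (p.1 ∈ S ∨ p.2 ∈ S)}

open Classical in
theorem incidentPairs_singleton_le (v : α) : incidentPairs K {v} ≤ 2 * K.degree v := by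
  have : ({p : α × α | K.Adj p.1 p.2 ∧ (p.1 ∈ ({v} : Finset α) ∨ p.2 ∈ ({v} : Finset α))} :
      Finset (α × α)) ⊆ (K.neighborFinset v).image (fun w => (v, w)) ∪
        (K.neighborFinset v).image (fun w => (w, v)) := by
    rintro ⟨x, y⟩ h
    simp only [mem_filter, mem_univ, true_and, Finset.mem_singleton] at h
    simp only [mem_union, Finset.mem_image, mem_neighborFinset, Prod.mk.injEq]
    rcases h with ⟨h, rfl | rfl⟩
    · exact .inl ⟨y, h, rfl, rfl⟩
    · exact .inr ⟨x, h.symm, rfl, rfl⟩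
  refine (Finset.card_le_card this).trans ((Finset.card_union_le _ _).trans ?_)
  have h1 := Finset.card_image_le (s := K.neighborFinset v) (f := fun w => (v, w))
  have h2 := Finset.card_image_le (s := K.neighborFinset v) (f := fun w => (w, v))
  rw [card_neighborFinset_eq_degree] at h1 h2
  omega

open Classical in
theorem incidentPairs_le_of_neighbors {S M : Finset α} (hSM : S ⊆ M)
    (h : ∀ v ∈ S, ∀ w, K.Adj v w → w ∈ M) : incidentPairs K S ≤ #M * #M - #M := by
  rw [← Finset.offDiag_card]
  refine Finset.card_le_card ?_
  rintro ⟨x, y⟩ hxy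
  simp only [mem_filter, mem_univ, true_and] at hxy
  rw [Finset.mem_offDiag]
  rcases hxy with ⟨hxy, hx | hy⟩
  · exact ⟨hSM hx, h x hx y hxy, hxy.ne⟩
  · exact ⟨h y hy x hxy.symm, hSM hy, hxy.ne⟩

end Alternating

/-! ### Connected graphs of high local density without long paths. -/

section Dense

variable {α : Type*} [Fintype α] {K : SimpleGraph α} {m : ℕ}

open Classical in
theorem le_degree_of_dense
    (hD : ∀ S : Finset α, S.Nonempty → (2 * m - 1) * #S < incidentPairs K S) (v : α) :
    m ≤ K.degree v := by
  have h1 := hD {v} (Finset.singleton_nonempty v)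
  have h2 := incidentPairs_singleton_le (K := K) v
  rw [Finset.card_singleton] at h1
  omega

theorem lt_card_of_dense [Nonempty α] (hm : 1 ≤ m)
    (hD : ∀ S : Finset α, S.Nonempty → (2 * m - 1) * #S < incidentPairs K S) :
    2 * m < Fintype.card α := by
  have h1 := hD univ univ_nonempty
  have h2 := incidentPairs_le_of_neighbors (K := K) (Finset.Subset.refl univ)
    (fun _ _ w _ => mem_univ w)
  rw [Finset.card_univ] at h1 h2
  have h3 : (2 * m - 1) * Fintype.card α < (Fintype.card α - 1) * Fintype.card α := by
    rw [Nat.sub_mul (Fintype.card α), one_mul]; omega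
  have := lt_of_mul_lt_mul_right h3 (Nat.zero_le _)
  omega

/-- A longest path that misses a vertex cannot be closed to a cycle, since connectivity would open
the cycle to a longer path. Its end chords then have disjoint index sets, each of size at least m,
so the path has at least 2m + 1 vertices. -/
theorem exists_path_of_dense [Nonempty α] (hK : K.Preconnected) (hm : 1 ≤ m)
    (hD : ∀ S : Finset α, S.Nonempty → (2 * m - 1) * #S < incidentPairs K S) :
    ∃ p, IsPathList K p ∧ p.length = 2 * m + 1 := by
  classical
  obtain ⟨p, hp, hne, hmax⟩ := exists_longest_path (K := K)
  suffices h : 2 * m + 1 ≤ p.length by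
    refine ⟨p.take (2 * m + 1), ?_, by simp; omega⟩
    rw [← List.take_append_drop (2 * m + 1) p, isPathList_append] at hp
    exact hp.1
  have hcard := lt_card_of_dense hm hD
  by_cases hlen : Fintype.card α ≤ p.length
  · omega
  obtain ⟨z, hz⟩ : ∃ z, z ∉ p := by
    by_contra! hall
    refine hlen ((Finset.card_le_card (s := univ) (t := p.toFinset) fun z _ => ?_).trans
      p.toFinset_card_le)
    simpa using hall z
  have hcyc : ∀ c, IsCycleList K c → c.length ≠ p.length := by
    intro c hc hcl
    obtain ⟨z, hz⟩ : ∃ z, z ∉ c := by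
      by_contra! hall
      refine hlen (hcl ▸ (Finset.card_le_card (s := univ) (t := c.toFinset) fun z _ => ?_).trans
        c.toFinset_card_le)
      simpa using hall z
    obtain ⟨l, hl, hll⟩ := hc.exists_longer_path hK (by
      rintro rfl; exact hne (List.length_eq_zero_iff.1 hcl.symm)) hz
    have := hmax l hl
    omega
  have hpos : 0 < p.length := List.length_pos_iff.2 hne
  obtain ⟨X, Y, -, -, hX, hY, hXY, hdX, hdY⟩ := chord_indices hp hmax hpos hcyc
  have h1 := Finset.card_le_card (Finset.union_subset hX hY)
  rw [Finset.card_union_of_disjoint hXY, Finset.card_range] at h1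
  have h2 := le_degree_of_dense hD p[0]
  have h3 := le_degree_of_dense hD p[p.length - 1]
  omega

/-- The two sets of chord indices now partition the 2m available indices into halves of size m. If i
is a chord index of the last vertex and i + 1 one of the first, there is a 2m-cycle omitting only
p[i + 1], which is also the head of a rotated longest path, so its neighbours lie on that cycle. If
this never happens, the indices of the first vertex form an initial segment. -/
theorem neighbors_head_or_exists_cycle {p : List α} (hp : IsPathList K p)
    (hlen : p.length = 2 * m + 1) (hm : 1 ≤ m)
    (hmax : ∀ l, IsPathList K l → l.length ≤ 2 * m + 1)
    (hcyc : ∀ c, IsCycleList K c → c.length ≠ 2 * m + 1)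
    (hD : ∀ S : Finset α, S.Nonempty → (2 * m - 1) * #S < incidentPairs K S) :
    (∀ i (h : i + 1 < p.length), K.Adj p[0] p[i + 1] ↔ i < m) ∨
    ∃ c x, IsCycleList K c ∧ c.length = 2 * m ∧ x ∉ c ∧ ∀ z, K.Adj x z → z ∈ c := by
  classical
  have hpos : 0 < p.length := by omega
  obtain ⟨X, Y, hX', hY', hX, hY, hXY, hdX, hdY⟩ := chord_indices hp
    (fun l hl => hlen ▸ hmax l hl) hpos (fun c hc => hlen ▸ hcyc c hc)
  have h1 := Finset.card_le_card (Finset.union_subset hX hY)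
  have h2 := le_degree_of_dense hD p[0]
  have h3 := le_degree_of_dense hD p[p.length - 1]
  rw [Finset.card_union_of_disjoint hXY, Finset.card_range] at h1
  have hunion : X ∪ Y = range (p.length - 1) :=
    Finset.eq_of_subset_of_card_le (Finset.union_subset hX hY) (by
      rw [Finset.card_union_of_disjoint hXY, Finset.card_range]; omega)
  have hXm : #X = m := by omega
  by_cases hsw : ∃ i, i + 1 ∈ X ∧ i ∈ Y
  · right
    obtain ⟨i, hiX, hiY⟩ := hsw
    obtain ⟨hi, hadj⟩ := (hX' _).1 hiX
    obtain ⟨hi', hadj'⟩ := (hY' _).1 hiY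
    have hrot := isPathList_rotation hp hi hadj
    have htake : (p.take (i + 1 + 1)).reverse = p[i + 1] :: (p.take (i + 1)).reverse := by
      rw [← List.take_concat_get' p (i + 1) hi', List.reverse_append]; simp
    rw [htake, List.cons_append] at hrot
    have hrot' := isPathList_cons.1 hrot
    refine ⟨_, p[i + 1], ⟨hrot'.2.2, fun x hx y hy => ?_⟩, ?_, hrot'.1, fun z hz => ?_⟩
    · rw [List.getLast?_append_of_ne_nil _ (List.ne_nil_of_length_pos (by simp; omega)),
        List.getLast?_drop, if_neg (by omega), List.getLast?_eq_getElem?,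
        List.getElem?_eq_getElem (by omega), Option.mem_some_iff] at hx
      rw [List.head?_append_of_ne_nil _ (List.ne_nil_of_length_pos (by simp; omega)),
        List.head?_reverse, List.getLast?_take, if_neg (by omega), Nat.add_sub_cancel,
        List.getElem?_eq_getElem (by omega), Option.some_or, Option.mem_some_iff] at hy
      exact hx ▸ hy ▸ hadj'
    · simp; omega
    · refine mem_of_adj_head hrot (fun l hl => (hmax l hl).trans ?_) hz
      simp; omega
  · left
    push Not at hsw
    have hdown : ∀ i, i + 1 ∈ X → i ∈ X := fun i hi => by
      have h4 := Finset.mem_range.1 (hX hi)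
      have : i ∈ X ∪ Y := hunion ▸ Finset.mem_range.2 (by omega)
      exact (Finset.mem_union.1 this).resolve_right (hsw i hi)
    have hdown' : ∀ j i, i + j ∈ X → i ∈ X := by
      intro j
      induction j with
      | zero => intro i h; exact h
      | succ j ih => intro i h; exact ih i (hdown _ h)
    have hXr : X = range m := by
      refine Finset.eq_of_subset_of_card_le (fun i hi => ?_) (by rw [Finset.card_range, hXm])
      have : range (i + 1) ⊆ X := fun j hj => by
        have := Finset.mem_range.1 hj
        exact hdown' (i - j) j (by rwa [show j + (i - j) = i by omega])
      have := Finset.card_le_card this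
      rw [Finset.card_range] at this
      exact Finset.mem_range.2 (by omega)
    intro i hi
    have h4 : i ∈ X ↔ i < m := by rw [hXr, Finset.mem_range]
    exact ⟨fun h => h4.1 ((hX' i).2 ⟨hi, h⟩), fun h => ((hX' i).1 (h4.2 h)).2⟩

/-- Either a suitable 2m-cycle exists and `exists_core_of_cycle` applies, or the head of every
longest path is adjacent exactly to the next m vertices. In the second case, rotations make each of
the first m vertices a head, so all their neighbours are among the first m + 1 vertices: too few
edges for the density condition. -/
theorem exists_core_of_dense (hK : K.Preconnected) (hm : 2 ≤ m)
    (hcard : 2 * m + 2 ≤ Fintype.card α)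
    (hmax : ∀ l, IsPathList K l → l.length ≤ 2 * m + 1)
    (hD : ∀ S : Finset α, S.Nonempty → (2 * m - 1) * #S < incidentPairs K S) :
    ∃ A : Finset α, #A = m ∧ ∀ v ∉ A, ∀ w, K.Adj v w ↔ w ∈ A := by
  classical
  have : Nonempty α := Fintype.card_pos_iff.1 (by omega)
  obtain ⟨p, hp, hlen⟩ := exists_path_of_dense hK (by omega) hD
  have hcyc : ∀ c, IsCycleList K c → c.length ≠ 2 * m + 1 := by
    intro c hc hcl
    obtain ⟨z, hz⟩ : ∃ z, z ∉ c := by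
      by_contra! hall
      have := (Finset.card_le_card (s := univ) (t := c.toFinset) fun z _ => by
        simpa using hall z).trans c.toFinset_card_le
      rw [Finset.card_univ] at this
      omega
    obtain ⟨l, hl, hll⟩ := hc.exists_longer_path hK (by rintro rfl; simp at hcl) hz
    have := hmax l hl
    omega
  by_cases hex : ∃ c x, IsCycleList K c ∧ c.length = 2 * m ∧ x ∉ c ∧ ∀ z, K.Adj x z → z ∈ c
  · obtain ⟨c, x, hc, hcl, hx, hN⟩ := hex
    exact exists_core_of_cycle hK (by omega) hc hcl hcyc hmax (le_degree_of_dense hD) hx hN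
  exfalso
  have hhead : ∀ p, IsPathList K p → p.length = 2 * m + 1 →
      ∀ i (h : i + 1 < p.length), K.Adj p[0] p[i + 1] ↔ i < m := fun p hp hlen =>
    (neighbors_head_or_exists_cycle hp hlen (by omega) hmax hcyc hD).resolve_right hex
  have hhead' : ∀ x l, IsPathList K (x :: l) → l.length = 2 * m → ∀ w, K.Adj x w →
      w ∈ (x :: l).take (m + 1) := by
    intro x l hxl hl w hw
    have hwl := mem_of_adj_head hxl (fun l' hl' => by have := hmax l' hl'; omega) hw
    obtain ⟨i, hi, rfl⟩ := List.getElem_of_mem hwl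
    have := (hhead _ hxl (by simp [hl]) i (by simpa using hi)).1 (by simpa using hw)
    rw [List.take_succ_cons]
    refine List.mem_cons_of_mem _ (List.mem_take_iff_getElem.2 ⟨i, by omega, rfl⟩)
  have hS : ∀ v ∈ (p.take m).toFinset, ∀ w, K.Adj v w → w ∈ (p.take (m + 1)).toFinset := by
    intro v hv w hw
    rw [List.mem_toFinset, List.mem_take_iff_getElem] at hv
    obtain ⟨i, hi, rfl⟩ := hv
    have hi' : i + 1 < p.length := by omega
    have hadj := (hhead p hp hlen i hi').2 (by omega)
    have hrot := isPathList_rotation hp hi' hadj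
    have htake : (p.take (i + 1)).reverse = p[i] :: (p.take i).reverse := by
      rw [← List.take_concat_get' p i (by omega), List.reverse_append]; simp
    rw [htake, List.cons_append] at hrot
    have := hhead' _ _ hrot (by simp; omega) w hw
    rw [← List.cons_append, ← htake, List.take_append, List.mem_append] at this
    rw [List.mem_toFinset, ← List.take_append_drop (i + 1) (p.take (m + 1)), List.mem_append,
      List.take_take, List.drop_take, min_eq_left (by omega)]
    rcases this with h | h
    · left; simpa using List.mem_of_mem_take h
    · right
      rwa [List.length_reverse, List.length_take, min_eq_left (by omega)] at h
  have hsub : (p.take m).toFinset ⊆ (p.take (m + 1)).toFinset := fun v hv => by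
    rw [List.mem_toFinset] at hv ⊢
    exact (List.take_subset_take_left p (by omega)) hv
  have hcardS : ∀ j ≤ 2 * m + 1, #(p.take j).toFinset = j := fun j hj => by
    rw [List.toFinset_card_of_nodup (hp.2.sublist (List.take_sublist j p)), List.length_take]
    omega
  have h1 := hD (p.take m).toFinset (by rw [← Finset.card_pos, hcardS m (by omega)]; omega)
  have h2 := incidentPairs_le_of_neighbors hsub hS
  rw [hcardS _ (by omega)] at h1 h2
  have h3 : (m + 1) * (m + 1) - (m + 1) = (m + 1) * m := by
    rw [← Nat.mul_sub_one]; rfl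
  -- This is where m ≥ 2 is needed.
  have h4 : (m + 1) * m ≤ (2 * m - 1) * m := Nat.mul_le_mul_right _ (by omega)
  omega

end Dense

/-! ### Dense subsets of a neighbourhood. -/

section DenseSubset

variable {V : Type*} [Fintype V] {G : SimpleGraph V}

/-- The number of ordered pairs of adjacent vertices in `U`. -/
noncomputable def innerPairs (G : SimpleGraph V) (U : Finset V) : ℕ :=
  open Classical in #{p ∈ U ×ˢ U | G.Adj p.1 p.2}

/-- Every nonempty part `S` of `U` meets more than `(2 m - 1) |S|` of the ordered pairs of
adjacent vertices in `U`. -/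
def DenseIn (G : SimpleGraph V) (m : ℕ) (U : Finset V) : Prop :=
  open Classical in ∀ S ⊆ U, S.Nonempty →
    (2 * m - 1) * #S < #{p ∈ U ×ˢ U | G.Adj p.1 p.2 ∧ (p.1 ∈ S ∨ p.2 ∈ S)}

-- A smallest subset of `N` with excess at least `c` works: deleting `S` lowers the excess below
-- `c`, so the pairs meeting `S` outnumber (2m - 1)|S|. Positivity of `c` rules out the empty set.
omit [Fintype V] in
theorem exists_denseIn_subset {m : ℕ} (hm : 1 ≤ m) {N : Finset V} {c : ℤ} (hc : 0 < c)
    (hN : c ≤ innerPairs G N - (2 * m - 1) * #N) :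
    ∃ U ⊆ N, U.Nonempty ∧ c ≤ innerPairs G U - (2 * m - 1) * #U ∧ DenseIn G m U := by
  classical
  let 𝒰 : Finset (Finset V) := {U ∈ N.powerset | c ≤ innerPairs G U - (2 * m - 1) * #U}
  obtain ⟨U, hU, hmin⟩ := Finset.exists_min_image 𝒰 Finset.card
    ⟨N, by simpa [𝒰] using hN⟩
  simp only [𝒰, mem_filter, mem_powerset] at hU hmin
  refine ⟨U, hU.1, ?_, hU.2, fun S hS hne => ?_⟩
  · rw [Finset.nonempty_iff_ne_empty]
    rintro rfl
    have := hU.2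
    simp [innerPairs] at this
    omega
  · have hlt : #(U \ S) < #U := Finset.card_lt_card (Finset.sdiff_ssubset hS hne)
    have h1 : ¬ c ≤ innerPairs G (U \ S) - (2 * m - 1) * #(U \ S) := fun h =>
      absurd (hmin (U \ S) ⟨Finset.sdiff_subset.trans hU.1, h⟩) (not_le.2 hlt)
    have h2 : innerPairs G U = innerPairs G (U \ S) +
        #{p ∈ U ×ˢ U | G.Adj p.1 p.2 ∧ (p.1 ∈ S ∨ p.2 ∈ S)} := by
      unfold innerPairs
      rw [← Finset.card_union_of_disjoint]
      · congr 1
        ext ⟨x, y⟩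
        simp only [mem_filter, mem_product, mem_union, mem_sdiff]
        tauto
      · rw [Finset.disjoint_left]
        rintro ⟨x, y⟩
        simp only [mem_filter, mem_product, mem_sdiff]
        tauto
    have h3 : #(U \ S) + #S = #U := Finset.card_sdiff_add_card_eq_card hS
    have h4 := hU.2
    rw [h2, ← h3] at h4
    push_cast at h4
    zify [show 1 ≤ 2 * m by omega]
    nlinarith

-- Density passes to unions of components of G[U], since no pair meeting `S` is lost. It serves both
-- for a single component and for G[U] itself.
omit [Fintype V] in
theorem DenseIn.dense_of_embedding {m : ℕ} {U : Finset V} (hU : DenseIn G m U) {β : Type*}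
    [Fintype β] {K : SimpleGraph β} (φ : K ↪g G) (hφ : ∀ b, φ b ∈ U)
    (hclosed : ∀ b, ∀ w ∈ U, G.Adj (φ b) w → ∃ b', φ b' = w) (S : Finset β) (hS : S.Nonempty) :
    (2 * m - 1) * #S < incidentPairs K S := by
  classical
  have h := hU (S.map φ.toEmbedding) (fun v hv => by
    obtain ⟨b, -, rfl⟩ := Finset.mem_map.1 hv
    exact hφ b) (hS.map)
  rw [Finset.card_map] at h
  refine h.trans_le ?_
  unfold incidentPairs
  refine le_trans (Finset.card_le_card ?_)
    (Finset.card_image_le (f := fun p : β × β => (φ p.1, φ p.2)))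
  rintro ⟨x, y⟩ hxy
  simp only [mem_filter, mem_product, Finset.mem_map, RelEmbedding.coe_toEmbedding] at hxy
  obtain ⟨⟨hx, hy⟩, hadj, hmem⟩ := hxy
  simp only [Finset.mem_image, mem_filter, mem_univ, true_and, Prod.mk.injEq, Prod.exists]
  rcases hmem with ⟨b, hb, rfl⟩ | ⟨b, hb, rfl⟩
  · obtain ⟨b', rfl⟩ := hclosed b y hy hadj
    exact ⟨b, b', ⟨φ.map_adj_iff.1 hadj, .inl hb⟩, rfl, rfl⟩
  · obtain ⟨b', rfl⟩ := hclosed b x hx hadj.symm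
    exact ⟨b', b, ⟨φ.map_adj_iff.1 hadj, .inr hb⟩, rfl, rfl⟩

omit [Fintype V] in
theorem IsPathList.map {β : Type*} {K : SimpleGraph β} (φ : K ↪g G) {l : List β}
    (h : IsPathList K l) : IsPathList G (l.map φ) :=
  ⟨(List.isChain_map φ).2 (h.1.imp fun _ _ hab => φ.map_adj_iff.2 hab), h.2.map φ.injective⟩

omit [Fintype V] in
theorem IsPathList.take {l : List V} (h : IsPathList G l) (n : ℕ) : IsPathList G (l.take n) := by
  rw [← List.take_append_drop n l, isPathList_append] at h
  exact h.1

/-- Each component of the subgraph induced by `U` has a path on `2 m + 1` vertices. -/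
theorem DenseIn.exists_path_component {m : ℕ} (hm : 1 ≤ m) {U : Finset V} (hU : DenseIn G m U)
    (C : (G.induce (U : Set V)).ConnectedComponent) :
    ∃ p, IsPathList G p ∧ p.length = 2 * m + 1 ∧
      ∀ v ∈ p, ∃ h : v ∈ U, (G.induce (U : Set V)).connectedComponentMk ⟨v, h⟩ = C := by
  classical
  let φ : C.toSimpleGraph ↪g G :=
    (Embedding.induce (U : Set V)).comp (Embedding.induce C.supp)
  have hφ : ∀ b, φ b = (b : (U : Set V)).1 := fun b => rfl
  have : Fintype C := Fintype.ofFinite _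
  have : Nonempty C := C.connected_toSimpleGraph.nonempty
  obtain ⟨p, hp, hlen⟩ := exists_path_of_dense C.connected_toSimpleGraph.preconnected hm
    (hU.dense_of_embedding φ (fun b => b.1.2) (fun b w hw hadj => by
      refine ⟨⟨⟨w, hw⟩, ?_⟩, rfl⟩
      have h1 : (G.induce (U : Set V)).Adj b.1 ⟨w, hw⟩ := hadj
      exact (C.mem_supp_congr_adj h1).1 b.2))
  refine ⟨p.map φ, hp.map φ, by simpa using hlen, fun v hv => ?_⟩
  obtain ⟨b, -, rfl⟩ := List.mem_map.1 hv
  exact ⟨b.1.2, b.2⟩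

variable {k : ℕ} {a : Fin k → ℕ} {u : V} {t : ℕ}

omit [Fintype V] in
theorem not_free_of_list (ht : t = ∑ i, a i) (hk : 0 < k) (ha : 2 ≤ a ⟨0, hk⟩) {l : List V}
    (hlen : l.length = 2 * t) (hl : l.Nodup)
    (hu : ∀ i (h : i < l.length), i ≠ 1 → G.Adj u l[i]) (hul : u ∉ l)
    (hadj : ∀ i (h : i + 1 < l.length), i + 1 ≠ 2 * a ⟨0, hk⟩ → G.Adj l[i] l[i + 1]) :
    ¬ (F a).Free G := by
  have hget : ∀ x (h : x < l.length), l.getD x u = l[x] := fun x h => by simp [h]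
  have hle : a ⟨0, hk⟩ ≤ t := ht ▸ Finset.single_le_sum (fun _ _ => Nat.zero_le _) (mem_univ _)
  refine not_free_of_seq_neighbors (u := u) ht hk ha (fun x => l.getD x u) ?_ ?_ ?_ ?_
  · intro x y hx hy h
    rw [← hlen] at hx hy
    simp only [hget _ hx, hget _ hy] at h
    exact (hl.getElem_inj_iff).1 h
  · intro x hx hx1
    rw [← hlen] at hx
    simp only [hget _ hx]
    exact hu x hx hx1
  · simp only [hget 1 (by omega)]
    exact fun h => hul (h ▸ List.getElem_mem _)
  · intro x hx hx1
    rw [← hlen] at hx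
    simp only [hget _ hx, hget x (by omega)]
    exact hadj x hx hx1

omit [Fintype V] in
theorem not_free_of_isPathList (ht : t = ∑ i, a i) (hk : 0 < k) (ha : 2 ≤ a ⟨0, hk⟩)
    {l : List V} (hlen : l.length = 2 * t) (hl : IsPathList G l)
    (hu : ∀ i (h : i < l.length), i ≠ 1 → G.Adj u l[i]) (hul : u ∉ l) : ¬ (F a).Free G :=
  not_free_of_list ht hk ha hlen hl.2 hu hul fun i h _ => List.isChain_iff_getElem.1 hl.1 i h

-- Two components would each contain a path on 2t - 1 vertices. The first cycle fits into one and
-- all the others into the other, because 2a_1 and 2t - 2a_1 are both at most 2t - 2.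
open Classical in
theorem DenseIn.preconnected (ht : t = ∑ i, a i) (hk : 2 ≤ k) (ha_pos : ∀ i, 1 ≤ a i)
    (ha : 2 ≤ a ⟨0, by omega⟩) (hF : (F a).Free G) {U : Finset V}
    (hUN : U ⊆ G.neighborFinset u) (hU : DenseIn G (t - 1) U) :
    (G.induce (U : Set V)).Preconnected := by
  have ha0 : a ⟨0, by omega⟩ + a ⟨1, by omega⟩ ≤ t := by
    rw [ht]
    calc _ = ∑ i ∈ {⟨0, by omega⟩, ⟨1, by omega⟩}, a i := by
          rw [Finset.sum_pair (by simp)]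
      _ ≤ _ := Finset.sum_le_sum_of_subset (Finset.subset_univ _)
  have ha1 := ha_pos ⟨1, by omega⟩
  set a₀ := a ⟨0, by omega⟩ with ha₀
  intro x y
  by_contra hxy
  obtain ⟨p, hp, hpl, hpC⟩ := hU.exists_path_component (by omega)
    ((G.induce (U : Set V)).connectedComponentMk x)
  obtain ⟨p', hp', hpl', hpC'⟩ := hU.exists_path_component (by omega)
    ((G.induce (U : Set V)).connectedComponentMk y)
  have hmem : ∀ v ∈ p.take (2 * a₀) ++ p'.take (2 * t - 2 * a₀), G.Adj u v := by
    intro v hv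
    rw [← G.mem_neighborFinset]
    rcases List.mem_append.1 hv with h | h
    · exact hUN (hpC v (List.mem_of_mem_take h)).1
    · exact hUN (hpC' v (List.mem_of_mem_take h)).1
  refine not_free_of_list (u := u) (l := p.take (2 * a₀) ++ p'.take (2 * t - 2 * a₀)) ht
    (by omega) ha ?_ ?_ ?_ ?_ ?_ hF
  · simp; omega
  · refine List.Nodup.append (hp.take _).2 (hp'.take _).2 fun v hv hv' => ?_
    obtain ⟨h1, h2⟩ := hpC v (List.mem_of_mem_take hv)
    obtain ⟨h3, h4⟩ := hpC' v (List.mem_of_mem_take hv')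
    exact hxy (ConnectedComponent.exact (h2.symm.trans h4))
  · intro i h _
    exact hmem _ (List.getElem_mem _)
  · exact fun h => (hmem _ h).ne rfl
  · intro i h hne
    have hl1 : (p.take (2 * a₀)).length = 2 * a₀ := by simp; omega
    by_cases hi : i + 1 < 2 * a₀
    · rw [List.getElem_append_left (by omega), List.getElem_append_left (by omega)]
      exact List.isChain_iff_getElem.1 (hp.take _).1 i _
    · rw [List.getElem_append_right (by omega), List.getElem_append_right (by omega)]
      have := List.isChain_iff_getElem.1 (hp'.take (2 * t - 2 * a₀)).1 (i - 2 * a₀)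
        (by simp at h ⊢; omega)
      simp only [hl1]
      convert this using 2
      omega

open Classical in
theorem DenseIn.exists_path (ht3 : 3 ≤ t) {U : Finset V} (hne : U.Nonempty)
    (hU : DenseIn G (t - 1) U) :
    ∃ p, IsPathList G p ∧ p.length = 2 * t - 1 ∧ ∀ v ∈ p, v ∈ U := by
  obtain ⟨x, hx⟩ := hne
  obtain ⟨p, hp, hpl, hpC⟩ := hU.exists_path_component (by omega)
    ((G.induce (U : Set V)).connectedComponentMk ⟨x, hx⟩)
  exact ⟨p, hp, by omega, fun v hv => (hpC v hv).1⟩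

open Classical in
theorem DenseIn.exists_core (ht : t = ∑ i, a i) (ht3 : 3 ≤ t) (hk : 2 ≤ k)
    (ha_pos : ∀ i, 1 ≤ a i) (ha : 2 ≤ a ⟨0, by omega⟩) (hF : (F a).Free G) {U : Finset V}
    (hUN : U ⊆ G.neighborFinset u) (hU : DenseIn G (t - 1) U) (hcard : 2 * t ≤ #U) :
    ∃ A ⊆ U, #A = t - 1 ∧ ∀ v ∈ U, v ∉ A → ∀ w ∈ U, G.Adj v w ↔ w ∈ A := by
  let φ : G.induce (U : Set V) ↪g G := Embedding.induce (U : Set V)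
  obtain ⟨A, hA, hAdj⟩ := exists_core_of_dense (K := G.induce (U : Set V)) (m := t - 1)
    (hU.preconnected ht hk ha_pos ha hF hUN) (by omega) (by simp; omega) (fun l hl => by
      by_contra hlt
      have hmem : ∀ v ∈ (l.take (2 * t)).map φ, G.Adj u v := by
        intro v hv
        obtain ⟨b, -, rfl⟩ := List.mem_map.1 hv
        rw [← G.mem_neighborFinset]
        exact hUN b.2
      refine not_free_of_isPathList (u := u) (l := (l.take (2 * t)).map φ) ht (by omega) ha ?_
        ((hl.take _).map φ) (fun i h _ => hmem _ (List.getElem_mem _))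
        (fun h => (hmem _ h).ne rfl) hF
      simp; omega)
    (hU.dense_of_embedding φ (fun b => b.2) fun b w hw _ => ⟨⟨w, hw⟩, rfl⟩)
  refine ⟨A.map φ.toEmbedding, fun v hv => ?_, by simpa using hA, fun v hv hvA w hw => ?_⟩
  · obtain ⟨b, -, rfl⟩ := Finset.mem_map.1 hv
    exact b.2
  · have hmap : ∀ w (hw : w ∈ U), w ∈ A.map φ.toEmbedding ↔ (⟨w, hw⟩ : (U : Set V)) ∈ A := by
      intro w hw
      rw [Finset.mem_map]
      exact ⟨fun ⟨b, hb, hbw⟩ => by subst hbw; exact hb, fun h => ⟨_, h, rfl⟩⟩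
    rw [hmap w hw]
    rw [hmap v hv] at hvA
    exact hAdj _ hvA ⟨w, hw⟩

end DenseSubset

/-! ### Counting around u, and copies of F produced by a core. -/

section Core

variable {V : Type*} {G : SimpleGraph V}

open Classical in
theorem exists_alternating_path (L : List V) (hL : L.Nodup) (B : Finset V)
    (hLB : ∀ x ∈ L, x ∉ B ∧ ∀ b ∈ B, G.Adj x b) (hcard : L.length ≤ #B) :
    ∃ l, IsPathList G l ∧ l.length = 2 * L.length ∧ l.head? = L.head? ∧
      ∀ v ∈ l, v ∈ L ∨ v ∈ B := by
  induction L generalizing B with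
  | nil => exact ⟨[], ⟨by simp, by simp⟩, by simp, by simp, by simp⟩
  | cons x L ih =>
    obtain ⟨b, hb⟩ : B.Nonempty := Finset.card_pos.1 (by simp at hcard; omega)
    rw [List.nodup_cons] at hL
    obtain ⟨l, hl, hlen, hhead, hmem⟩ := ih hL.2 (B.erase b) (fun y hy => by
      obtain ⟨h1, h2⟩ := hLB y (List.mem_cons_of_mem _ hy)
      exact ⟨fun h => h1 (Finset.mem_of_mem_erase h),
        fun c hc => h2 c (Finset.mem_of_mem_erase hc)⟩) (by
      rw [Finset.card_erase_of_mem hb]; simp at hcard; omega)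
    obtain ⟨hx1, hx2⟩ := hLB x List.mem_cons_self
    have hxl : x ∉ l := fun h => (hmem x h).elim hL.1 fun h => hx1 (Finset.mem_of_mem_erase h)
    have hbl : b ∉ l := fun h => (hmem b h).elim
      (fun h => (hLB b (List.mem_cons_of_mem _ h)).1 hb) fun h => by simp at h
    refine ⟨x :: b :: l, isPathList_cons.2 ⟨?_, by simpa using hx2 b hb,
      isPathList_cons.2 ⟨hbl, fun y hy => ?_, hl⟩⟩, by simp [hlen]; ring, by simp, ?_⟩
    · simp [hxl, (hx2 b hb).ne]
    · rw [hhead] at hy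
      exact ((hLB y (List.mem_cons_of_mem _ (List.mem_of_mem_head? hy))).2 b hb).symm
    · intro v hv
      simp only [List.mem_cons] at hv ⊢
      rcases hv with rfl | rfl | hv
      · exact .inl (.inl rfl)
      · exact .inr hb
      · exact (hmem v hv).imp .inr Finset.mem_of_mem_erase

theorem innerPairs_le (U : Finset V) : innerPairs G U ≤ #U * #U - #U := by
  classical
  rw [← Finset.offDiag_card]
  refine Finset.card_le_card ?_
  rintro ⟨x, y⟩ hxy
  simp only [mem_filter, mem_product] at hxy
  exact Finset.mem_offDiag.2 ⟨hxy.1.1, hxy.1.2, hxy.2.ne⟩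

theorem innerPairs_le_of_core {U A : Finset V} (hA : A ⊆ U)
    (h : ∀ v ∈ U, v ∉ A → ∀ w ∈ U, G.Adj v w ↔ w ∈ A) :
    (innerPairs G U : ℝ) ≤ 2 * #A * #U - #A * #A - #A := by
  classical
  have hsub : ({p ∈ U ×ˢ U | G.Adj p.1 p.2} : Finset (V × V)) ⊆
      A.offDiag ∪ (A ×ˢ (U \ A) ∪ (U \ A) ×ˢ A) := by
    rintro ⟨x, y⟩ hxy
    simp only [mem_filter, mem_product] at hxy
    obtain ⟨⟨hx, hy⟩, hadj⟩ := hxy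
    have h1 := h x hx
    have h2 := h y hy
    have h3 := hadj.ne
    have h4 := hadj.symm
    simp only [mem_union, Finset.mem_offDiag, mem_product, mem_sdiff]
    by_cases hxA : x ∈ A <;> by_cases hyA : y ∈ A
    · tauto
    · tauto
    · tauto
    · exact absurd ((h1 hxA y hy).1 hadj) hyA
  have h1 := (Finset.card_le_card hsub).trans ((Finset.card_union_le _ _).trans
    (Nat.add_le_add_left (Finset.card_union_le _ _) _))
  rw [Finset.offDiag_card, Finset.card_product, Finset.card_product,
    Finset.card_sdiff_of_subset hA] at h1
  have h2 := Finset.card_le_card hA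
  have h3 : #A ≤ #A * #A := Nat.le_mul_self _
  have h4 : (innerPairs G U : ℝ) ≤ ((#A * #A - #A + (#A * (#U - #A) + (#U - #A) * #A) : ℕ) : ℝ) := by
    exact_mod_cast h1
  push_cast [Nat.cast_sub h2, Nat.cast_sub h3] at h4
  linarith

variable [Fintype V]

/-- The vertices different from `u` and not adjacent to `u`. -/
noncomputable def farVertices (G : SimpleGraph V) (u : V) : Finset V :=
  open Classical in {w | w ≠ u ∧ ¬ G.Adj u w}

/-- The number of nonadjacent pairs of a neighbour of `u` and a vertex far from `u`. -/
noncomputable def missingPairs (G : SimpleGraph V) (u : V) : ℕ :=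
  open Classical in #{p ∈ G.neighborFinset u ×ˢ farVertices G u | ¬ G.Adj p.1 p.2}

open Classical in
theorem mem_farVertices {u w : V} : w ∈ farVertices G u ↔ w ≠ u ∧ ¬ G.Adj u w := by
  simp [farVertices]

open Classical in
theorem card_eq_degree_add_card_farVertices (u : V) :
    Fintype.card V = G.degree u + #(farVertices G u) + 1 := by
  rw [← card_neighborFinset_eq_degree, ← Finset.card_union_of_disjoint, ← Finset.card_univ]
  · rw [← Finset.card_insert_of_notMem (a := u)]
    · congr 1
      ext w
      simp only [mem_univ, Finset.mem_insert, mem_union, mem_neighborFinset, mem_farVertices]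
      tauto
    · simp [mem_farVertices]
  · rw [Finset.disjoint_left]
    intro w hw hw'
    exact (mem_farVertices.1 hw').2 (by simpa using hw)

-- The neighbours of each w in N(u) are u itself, vertices of N(u) and far vertices; the far ones
-- are counted as all minus the missing ones.
open Classical in
theorem sum_degree_neighbors (u : V) :
    ∑ w ∈ G.neighborFinset u, G.degree w + missingPairs G u =
      G.degree u + innerPairs G (G.neighborFinset u) + G.degree u * #(farVertices G u) := by
  have h1 : innerPairs G (G.neighborFinset u) =
      ∑ w ∈ G.neighborFinset u, #{z ∈ G.neighborFinset u | G.Adj w z} := by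
    unfold innerPairs
    simp only [Finset.card_filter, Finset.sum_product]
  have h2 : missingPairs G u =
      ∑ w ∈ G.neighborFinset u, #{z ∈ farVertices G u | ¬ G.Adj w z} := by
    unfold missingPairs
    simp only [Finset.card_filter, Finset.sum_product]
  have h3 : ∀ w ∈ G.neighborFinset u, G.degree w + #{z ∈ farVertices G u | ¬ G.Adj w z} =
      1 + #{z ∈ G.neighborFinset u | G.Adj w z} + #(farVertices G u) := by
    intro w hw
    rw [mem_neighborFinset] at hw
    have h4 : G.neighborFinset w = insert u ({z ∈ G.neighborFinset u | G.Adj w z} ∪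
        {z ∈ farVertices G u | G.Adj w z}) := by
      ext z
      simp only [mem_neighborFinset, Finset.mem_insert, mem_union, mem_filter, mem_farVertices]
      constructor
      · intro h; tauto
      · rintro (rfl | h | h)
        exacts [hw.symm, h.2, h.2]
    have h5 := Finset.card_filter_add_card_filter_not (s := farVertices G u) (fun z => G.Adj w z)
    rw [← card_neighborFinset_eq_degree, h4, Finset.card_insert_of_notMem,
      Finset.card_union_of_disjoint]
    · omega
    · rw [Finset.disjoint_left]
      intro z hz hz'
      simp only [mem_filter, mem_neighborFinset, mem_farVertices] at hz hz'
      exact hz'.1.2 hz.1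
    · simp [mem_farVertices]
  rw [h2, h1, ← Finset.sum_add_distrib, Finset.sum_congr rfl h3]
  simp only [Finset.sum_add_distrib, Finset.sum_const, smul_eq_mul, mul_one,
    card_neighborFinset_eq_degree]

variable {k : ℕ} {a : Fin k → ℕ} {u : V} {t : ℕ}

open Classical in
/-- Many vertices far from `u` adjacent to all neighbours of `u` give a forbidden subgraph. -/
theorem card_farVertices_lt (ht : t = ∑ i, a i) (hk : 0 < k) (ha : 2 ≤ a ⟨0, hk⟩)
    (hF : (F a).Free G) {p : List V} (hp : IsPathList G p) (hpl : p.length = 2 * t - 1)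
    (hpu : ∀ v ∈ p, G.Adj u v) : #(farVertices G u) < missingPairs G u + t := by
  by_contra! hle
  set W := {w ∈ farVertices G u | ∀ v ∈ G.neighborFinset u, G.Adj v w} with hW
  have hmiss : #{w ∈ farVertices G u | ¬ ∀ v ∈ G.neighborFinset u, G.Adj v w} ≤
      missingPairs G u := by
    refine le_trans (Finset.card_le_card ?_) (Finset.card_image_le (f := Prod.snd))
    intro w hw
    simp only [mem_filter] at hw
    obtain ⟨hw1, hw2⟩ := hw
    push Not at hw2
    obtain ⟨v, hv, hvw⟩ := hw2
    exact Finset.mem_image.2 ⟨(v, w), by simp [hw1, hvw, by simpa using hv], rfl⟩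
  have hadd := Finset.card_filter_add_card_filter_not (s := farVertices G u)
    (fun w => ∀ v ∈ G.neighborFinset u, G.Adj v w)
  have hcard : t ≤ W.toList.length := by
    rw [Finset.length_toList, hW]; omega
  have hWmem : ∀ x (h : x < W.toList.length), W.toList[x] ∈ W := fun x h =>
    Finset.mem_toList.1 (List.getElem_mem h)
  have hgetp : ∀ x (h : x < p.length), p.getD x u = p[x] := fun x h => by simp [h]
  have hgetW : ∀ x (h : x < W.toList.length), W.toList.getD x u = W.toList[x] := fun x h => by
    rw [List.getD_eq_getElem _ _ h]
  refine not_free_of_path_of_complete (u := u) ht hk ha (fun x => p.getD x u)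
    (fun x => W.toList.getD x u) ?_ ?_ ?_ ?_ ?_ ?_ hF
  · intro x y hx hy h
    rw [← hpl] at hx hy
    simp only [hgetp x hx, hgetp y hy] at h
    exact (hp.2.getElem_inj_iff).1 h
  · intro x hx
    rw [← hpl] at hx
    simp only [hgetp x hx]
    exact hpu _ (List.getElem_mem hx)
  · intro x hx
    rw [← hpl] at hx
    simp only [hgetp _ hx, hgetp x (by omega)]
    exact List.isChain_iff_getElem.1 hp.1 x hx
  · intro x y hx hy h
    simp only [hgetW x (by omega), hgetW y (by omega)] at h
    exact ((Finset.nodup_toList W).getElem_inj_iff).1 h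
  · intro x hx
    simp only [hgetW x (by omega)]
    exact mem_farVertices.1 (Finset.mem_filter.1 (hWmem x (by omega))).1
  · intro x y hx hy
    rw [← hpl] at hx
    simp only [hgetp x hx, hgetW y (by omega)]
    exact (Finset.mem_filter.1 (hWmem y (by omega))).2 _
      (by simpa using hpu _ (List.getElem_mem hx))

open Classical in
/-- If the neighbourhood of `u` contains a large complete bipartite graph with a part of size
`t - 1`, then each vertex far from `u` misses almost all of the other part. -/
theorem card_adj_farVertex_le_one (ht : t = ∑ i, a i) (ht1 : 1 ≤ t) (hk : 0 < k)
    (ha : 2 ≤ a ⟨0, hk⟩) (hF : (F a).Free G) {A B : Finset V} (hA : #A = t - 1)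
    (hAu : ∀ v ∈ A, G.Adj u v) (hBu : ∀ v ∈ B, G.Adj u v) (hAB : Disjoint A B)
    (hadj : ∀ v ∈ A, ∀ w ∈ B, G.Adj v w) (hB : t + 1 ≤ #B) {w : V}
    (hw : w ∈ farVertices G u) : #{b ∈ B | G.Adj b w} ≤ 1 := by
  by_contra! hlt
  obtain ⟨b₀, hb₀, b₁, hb₁, hne⟩ := Finset.one_lt_card.1 hlt
  simp only [mem_filter] at hb₀ hb₁
  obtain ⟨hwu, hwu'⟩ := mem_farVertices.1 hw
  have hBcard : t - 1 ≤ #((B.erase b₀).erase b₁) := by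
    rw [Finset.card_erase_of_mem (by simp [hb₁.1, hne.symm]), Finset.card_erase_of_mem hb₀.1]
    omega
  obtain ⟨l, hl, hlen, hhead, hmem⟩ := exists_alternating_path (G := G) A.toList
    A.nodup_toList ((B.erase b₀).erase b₁) (fun x hx => by
      rw [Finset.mem_toList] at hx
      refine ⟨fun h => Finset.disjoint_left.1 hAB hx
        (Finset.mem_of_mem_erase (Finset.mem_of_mem_erase h)), fun b hb => hadj x hx b
        (Finset.mem_of_mem_erase (Finset.mem_of_mem_erase hb))⟩) (by
      rw [Finset.length_toList, hA]; exact hBcard)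
  simp only [Finset.mem_toList, Finset.mem_erase] at hmem
  rw [Finset.length_toList, hA] at hlen
  have hlu : ∀ v ∈ l, G.Adj u v := fun v hv => (hmem v hv).elim (hAu v) fun h => hBu v h.2.2
  have hbA : ∀ b ∈ B, b ∉ A := fun b hb h => Finset.disjoint_left.1 hAB h hb
  have hb₀l : b₀ ∉ l := fun h => by have := hmem _ h; have := hbA _ hb₀.1; tauto
  have hb₁l : b₁ ∉ l := fun h => by have := hmem _ h; have := hbA _ hb₁.1; tauto
  have hwl : w ∉ l := fun h => hwu' (hlu w h)
  -- This path has 2t + 1 vertices and is cut to 2t. Its only nonneighbour of `u` is `w`, at index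
  -- 1, an inner position of the first cycle because that cycle has length at least 5.
  have hp : IsPathList G (b₀ :: w :: b₁ :: l) := by
    refine isPathList_cons.2 ⟨?_, by simpa using hb₀.2, isPathList_cons.2 ⟨?_,
      by simpa using hb₁.2.symm, isPathList_cons.2 ⟨hb₁l, fun y hy => ?_, hl⟩⟩⟩
    · simp [hne, hb₀.2.ne, hb₀l]
    · simp [hb₁.2.ne', hwl]
    · rw [hhead] at hy
      exact (hadj y (Finset.mem_toList.1 (List.mem_of_mem_head? hy)) b₁ hb₁.1).symm
  refine not_free_of_isPathList (u := u) (l := (b₀ :: w :: b₁ :: l).take (2 * t)) ht hk ha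
    (by simp [hlen]; omega) (hp.take _) ?_ (fun h => ?_) hF
  · intro i h hi
    rw [List.getElem_take]
    match i with
    | 0 => exact hBu _ hb₀.1
    | 2 => exact hBu _ hb₁.1
    | j + 3 => exact hlu _ (List.getElem_mem _)
  · have h' := List.mem_of_mem_take h
    simp only [List.mem_cons] at h'
    rcases h' with h' | h' | h' | h'
    exacts [(hBu _ hb₀.1).ne h', hwu h'.symm, (hBu _ hb₁.1).ne h', (hlu u h').ne rfl]

omit [Fintype V] in
open Classical in
/-- An edge in the neighbourhood of `u` outside the part `A` of a large complete bipartite graph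
has no neighbour in `A`. -/
theorem not_adj_core_of_adj (ht : t = ∑ i, a i) (ht1 : 1 ≤ t) (hk : 0 < k)
    (ha : 2 ≤ a ⟨0, hk⟩) (hF : (F a).Free G) {A B : Finset V} (hA : #A = t - 1)
    (hAu : ∀ v ∈ A, G.Adj u v) (hBu : ∀ v ∈ B, G.Adj u v) (hAB : Disjoint A B)
    (hadj : ∀ v ∈ A, ∀ w ∈ B, G.Adj v w) (hB : t + 1 ≤ #B) {z₁ z₂ : V} (hz₁ : z₁ ∉ A)
    (hz₂ : z₂ ∉ A) (hz₁u : G.Adj u z₁) (hz₂u : G.Adj u z₂) (hz : G.Adj z₁ z₂) {x : V}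
    (hx : x ∈ A) : ¬ G.Adj z₁ x := by
  intro hzx
  have hBcard : t - 1 ≤ #((B.erase z₁).erase z₂) := by
    have h1 := Finset.pred_card_le_card_erase (s := B) (a := z₁)
    have h2 := Finset.pred_card_le_card_erase (s := B.erase z₁) (a := z₂)
    omega
  have hmemL : ∀ y, y ∈ x :: (A.erase x).toList ↔ y ∈ A := fun y => by
    rw [List.mem_cons, Finset.mem_toList, Finset.mem_erase]
    constructor
    · rintro (rfl | h)
      exacts [hx, h.2]
    · tauto
  have hApos : 0 < #A := Finset.card_pos.2 ⟨x, hx⟩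
  have hlenL : (x :: (A.erase x).toList).length = t - 1 := by
    rw [List.length_cons, Finset.length_toList, Finset.card_erase_of_mem hx]
    omega
  -- With `x` listed first the alternating path starts at `x`, so z₂, z₁ can be put in front of it,
  -- giving 2t neighbours of `u`.
  obtain ⟨l, hl, hlen, hhead, hmem⟩ := exists_alternating_path (G := G)
    (x :: (A.erase x).toList) (by simp [Finset.nodup_toList]) ((B.erase z₁).erase z₂)
    (fun y hy => by
      rw [hmemL] at hy
      refine ⟨fun h => Finset.disjoint_left.1 hAB hy
        (Finset.mem_of_mem_erase (Finset.mem_of_mem_erase h)), fun b hb => hadj y hy b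
        (Finset.mem_of_mem_erase (Finset.mem_of_mem_erase hb))⟩) (by
      rw [hlenL]; exact hBcard)
  simp only [hmemL, Finset.mem_erase] at hmem
  rw [hlenL] at hlen
  have hlu : ∀ v ∈ l, G.Adj u v := fun v hv => (hmem v hv).elim (hAu v) fun h => hBu v h.2.2
  have hz₁l : z₁ ∉ l := fun h => by have := hmem _ h; tauto
  have hz₂l : z₂ ∉ l := fun h => by have := hmem _ h; tauto
  have hall : ∀ v ∈ z₂ :: z₁ :: l, G.Adj u v := by
    intro v hv
    simp only [List.mem_cons] at hv
    rcases hv with rfl | rfl | hv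
    exacts [hz₂u, hz₁u, hlu v hv]
  refine not_free_of_isPathList (u := u) (l := z₂ :: z₁ :: l) ht hk ha
    (by simp [hlen]; omega) ?_ (fun i h _ => hall _ (List.getElem_mem _))
    (fun h => (hall u h).ne rfl) hF
  refine isPathList_cons.2 ⟨by simp [hz.ne', hz₂l], by simpa using hz.symm,
    isPathList_cons.2 ⟨hz₁l, fun y hy => ?_, hl⟩⟩
  rw [hhead] at hy
  simp only [List.head?_cons, Option.mem_some_iff] at hy
  exact hy ▸ hzx

end Core

/-! ### From a large q(G) to the structure of G. -/

section Main

variable {V : Type*} [Fintype V] {G : SimpleGraph V} {k : ℕ} {a : Fin k → ℕ} {t n : ℕ}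

open Classical in
/-- A vertex at which the bound `d(u) + m(u)` is large has many pairs of adjacent neighbours. -/
theorem exists_innerPairs_ge [Nonempty V] (ht3 : 3 ≤ t)
    (hn : 8 * (t : ℝ) ^ 2 - 12 * t + 9 ≤ n) (hV : Fintype.card V = n) (hq : qS n t ≤ q G) :
    ∃ u, 0 < G.degree u ∧ G.degree u * (qS n t - n) + missingPairs G u ≤
      innerPairs G (G.neighborFinset u) := by
  obtain ⟨-, h2⟩ := qS_spec ht3 hn
  have ht' : (3 : ℝ) ≤ t := by exact_mod_cast ht3
  have hqpos : 0 < qS n t := by nlinarith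
  obtain ⟨u, hu, hle⟩ := exists_q_mul_degree_le G (hqpos.trans_le hq)
  refine ⟨u, hu, ?_⟩
  have h3 := sum_degree_neighbors (G := G) u
  have h4 := card_eq_degree_add_card_farVertices (G := G) u
  rw [hV] at h4
  have h3' : (∑ w ∈ G.neighborFinset u, (G.degree w : ℝ)) + missingPairs G u =
      G.degree u + innerPairs G (G.neighborFinset u) +
        G.degree u * #(farVertices G u) := by exact_mod_cast h3
  have h4' : (n : ℝ) = G.degree u + #(farVertices G u) + 1 := by exact_mod_cast h4
  have h5 : qS n t * G.degree u ≤ q G * G.degree u :=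
    mul_le_mul_of_nonneg_right hq (Nat.cast_nonneg _)
  have h6 : (#(farVertices G u) : ℝ) = n - G.degree u - 1 := by linarith
  rw [h6] at h3'
  -- After substituting n - d - 1 for the number of far vertices, the terms d² and d cancel.
  nlinarith

open Classical in
/-- The neighbourhood of the vertex `u` contains a large complete bipartite graph with a part of
size `t - 1`, and the neighbourhoods leave few pairs out. -/
theorem exists_core_in_neighborhood (ht : t = ∑ i, a i) (ht3 : 3 ≤ t) (hk : 2 ≤ k)
    (ha_pos : ∀ i, 1 ≤ a i) (ha : 2 ≤ a ⟨0, by omega⟩) (hF : (F a).Free G)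
    (hn : 8 * (t : ℝ) ^ 2 - 12 * t + 9 ≤ n) (hV : Fintype.card V = n) {u : V}
    (hdpos : 0 < G.degree u) (hu : G.degree u * (qS n t - n) + missingPairs G u ≤
      innerPairs G (G.neighborFinset u)) :
    ∃ U ⊆ G.neighborFinset u, ∃ A ⊆ U, #A = t - 1 ∧
      (∀ v ∈ U, v ∉ A → ∀ w ∈ U, G.Adj v w ↔ w ∈ A) ∧
      missingPairs G u + G.degree u ≤ #U + t * (t - 1) ∧ 2 * t * t + t ≤ #U + t * (t - 1) := by
  obtain ⟨h1, h2⟩ := qS_spec ht3 hn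
  have ht' : (3 : ℝ) ≤ t := by exact_mod_cast ht3
  set Q := qS n t with hQ
  have hcast : ((t - 1 : ℕ) : ℝ) = t - 1 := by rw [Nat.cast_sub (by omega), Nat.cast_one]
  have hcastZ : ((t - 1 : ℕ) : ℤ) = t - 1 := by rw [Nat.cast_sub (by omega), Nat.cast_one]
  set N := G.neighborFinset u with hN
  have hNcard : #N = G.degree u := card_neighborFinset_eq_degree G u
  set d := G.degree u
  have hd1 : (1 : ℝ) ≤ d := by exact_mod_cast hdpos
  have hmiss0 : (0 : ℝ) ≤ missingPairs G u := Nat.cast_nonneg _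
  have hfar := card_eq_degree_add_card_farVertices (G := G) u
  rw [hV] at hfar
  have hfar' : (n : ℝ) = d + #(farVertices G u) + 1 := by exact_mod_cast hfar
  have hfar0 : (0 : ℝ) ≤ #(farVertices G u) := Nat.cast_nonneg _
  -- `δ` is the amount by which `Q` falls short of `n + 2 t - 2`
  obtain ⟨δ, hδ⟩ : ∃ δ : ℝ, δ = n + 2 * t - 2 - Q := ⟨_, rfl⟩
  rw [← hδ] at h1
  have hQbig : 8 * (t : ℝ) ^ 2 - 10 * t + 6 ≤ Q := by linarith
  have hQpos : 0 < Q := by nlinarith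
  have hδ0 : 0 < δ := by
    by_contra hneg
    have : Q * δ ≤ 0 := mul_nonpos_of_nonneg_of_nonpos hQpos.le (not_lt.1 hneg)
    nlinarith
  have hδ2 : δ ≤ 1 / 2 := by
    by_contra hneg
    have : Q * (1 / 2) < Q * δ := mul_lt_mul_of_pos_left (not_le.1 hneg) hQpos
    nlinarith
  -- The right side is the excess of N over the density 2m - 1 = 2t - 3 with m = t - 1; it is
  -- positive because δ ≤ 1/2.
  have hc : (d : ℝ) * (1 - δ) + missingPairs G u ≤
      innerPairs G N - (2 * (t - 1) - 1) * d := by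
    have : Q - n = 2 * t - 2 - δ := by linarith
    rw [this] at hu
    linarith
  have hdδ : (d : ℝ) * (1 / 2) ≤ d * (1 - δ) :=
    mul_le_mul_of_nonneg_left (by linarith) (by linarith)
  obtain ⟨c, hcdef⟩ : ∃ c : ℤ, c = innerPairs G N - (2 * ((t - 1 : ℕ) : ℤ) - 1) * #N := ⟨_, rfl⟩
  have hcR : (c : ℝ) = innerPairs G N - (2 * (t - 1) - 1) * d := by
    rw [hcdef, hNcard]; push_cast [hcast]; ring
  have hcpos : 0 < c := by
    have : (0 : ℝ) < c := by linarith
    exact_mod_cast this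
  obtain ⟨U, hUN, hUne, hcU, hU⟩ := exists_denseIn_subset (G := G) (m := t - 1) (by omega) hcpos
    hcdef.le
  have hcU' : (c : ℝ) ≤ innerPairs G U - (2 * (t - 1) - 1) * #U := by
    have : (c : ℝ) ≤ ((innerPairs G U - (2 * ((t - 1 : ℕ) : ℤ) - 1) * #U : ℤ) : ℝ) := by
      exact_mod_cast hcU
    push_cast [hcast] at this
    exact this
  have hUd : (#U : ℝ) ≤ d := by
    rw [← hNcard]; exact_mod_cast Finset.card_le_card hUN
  by_cases hcard : 2 * t ≤ #U
  · obtain ⟨A, hAU, hA, hcore⟩ := hU.exists_core ht ht3 hk ha_pos ha hF hUN hcard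
    have hin := innerPairs_le_of_core hAU hcore
    rw [hA, hcast] at hin
    have hdQ : (d : ℝ) ≤ Q := by linarith
    have hδd : d * δ ≤ 2 * t * (t - 1) := by
      rw [← h1]; exact mul_le_mul_of_nonneg_right hdQ hδ0.le
    have key : (missingPairs G u : ℝ) + d * (1 - δ) ≤ #U - t * (t - 1) := by linarith
    -- From `key` and |U| ≤ d one gets dδ ≥ t(t - 1) = Qδ/2; this lower bound on d is what makes `U`
    -- large.
    have hQd : Q ≤ 2 * d := by
      have : Q * δ ≤ 2 * d * δ := by rw [h1]; linarith
      exact le_of_mul_le_mul_right this hδ0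
    refine ⟨U, hUN, A, hAU, hA, hcore, ?_, ?_⟩
    · have : (missingPairs G u : ℝ) + d ≤ #U + t * ((t - 1 : ℕ) : ℝ) := by
        rw [hcast]; linarith
      exact_mod_cast this
    · have : 2 * (t : ℝ) * t + t ≤ #U + t * ((t - 1 : ℕ) : ℝ) := by
        rw [hcast]; nlinarith
      exact_mod_cast this
  · exfalso
    obtain ⟨p, hp, hpl, hpU⟩ := hU.exists_path ht3 hUne
    -- Such a small `U` has excess at most 2t - 1, which bounds d/2 plus the missing pairs; with few
    -- far vertices, n would be less than 5t.
    have hUcard : #U = 2 * t - 1 := by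
      have h3 := Finset.card_le_card (s := p.toFinset) (t := U) fun v hv =>
        hpU v (List.mem_toFinset.1 hv)
      rw [List.toFinset_card_of_nodup hp.2] at h3
      omega
    have hUR : (#U : ℝ) = 2 * t - 1 := by
      rw [hUcard, Nat.cast_sub (by omega)]; push_cast; ring
    have hin : (innerPairs G U : ℝ) ≤ #U * #U - #U := by
      have h3 := innerPairs_le (G := G) U
      have h4 : #U ≤ #U * #U := Nat.le_mul_self _
      have h5 : (innerPairs G U : ℝ) ≤ ((#U * #U - #U : ℕ) : ℝ) := by exact_mod_cast h3
      push_cast [Nat.cast_sub h4] at h5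
      exact h5
    have hlt := card_farVertices_lt (u := u) ht (by omega) ha hF hp hpl (fun v hv => by
      rw [← mem_neighborFinset]; exact hUN (hpU v hv))
    have hlt' : (#(farVertices G u) : ℝ) < missingPairs G u + t := by exact_mod_cast hlt
    rw [hUR] at hin hcU'
    nlinarith

open Classical in
theorem exists_core_of_qS_le [Nonempty V] (ht : t = ∑ i, a i) (ht3 : 3 ≤ t) (hk : 2 ≤ k)
    (ha_pos : ∀ i, 1 ≤ a i) (ha : 2 ≤ a ⟨0, by omega⟩) (hF : (F a).Free G)
    (hn : 8 * (t : ℝ) ^ 2 - 12 * t + 9 ≤ n) (hV : Fintype.card V = n) (hq : qS n t ≤ q G) :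
    ∃ (T : Finset V) (u : V), #T = t ∧ (∀ v, v ≠ u → G.Adj u v) ∧
      ∀ v ∉ T, (∀ w, G.Adj v w → w ∈ T) ∨ ((∀ w ∈ T, G.Adj v w → w = u) ∧
        2 * (t : ℝ) * #{w | G.Adj v w ∧ w ∉ T} < (t - 1) * qS n t) := by
  obtain ⟨u, hdpos, hu⟩ := exists_innerPairs_ge ht3 hn hV hq
  obtain ⟨U, hUN, A, hAU, hA, hcore, hmiss, hUbig⟩ := exists_core_in_neighborhood ht ht3 hk
    ha_pos ha hF hn hV hdpos hu
  have hUu : ∀ v ∈ U, G.Adj u v := fun v hv => (G.mem_neighborFinset u v).1 (hUN hv)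
  have htt : t * (t - 1) + t = t * t := by
    rw [← Nat.mul_succ]; congr 1; omega
  have hUbig' : t * t + 2 * t ≤ #U := by
    rw [Nat.mul_assoc] at hUbig; omega
  have hUd : #U ≤ G.degree u := by
    rw [← card_neighborFinset_eq_degree]; exact Finset.card_le_card hUN
  have hBcard : #(U \ A) = #U - (t - 1) := by rw [Finset.card_sdiff_of_subset hAU, hA]
  have hAu : ∀ v ∈ A, G.Adj u v := fun v hv => hUu v (hAU hv)
  have hBu : ∀ v ∈ U \ A, G.Adj u v := fun v hv => hUu v (Finset.mem_sdiff.1 hv).1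
  have hAB : Disjoint A (U \ A) := Finset.disjoint_sdiff
  have hadj : ∀ v ∈ A, ∀ w ∈ U \ A, G.Adj v w := fun v hv w hw => by
    rw [Finset.mem_sdiff] at hw
    exact ((hcore w hw.1 hw.2 v (hAU hv)).2 hv).symm
  have hBbig : t + 1 ≤ #(U \ A) := by rw [hBcard]; omega
  -- A far vertex misses all but at most one vertex of `U \ A`, so there are at least |U| - t
  -- missing pairs. Then `hmiss` and |U| ≤ d give |U| ≤ t², against `hUbig'`.
  have hdom : ∀ v, v ≠ u → G.Adj u v := by
    by_contra! hex
    obtain ⟨w, hwu, hw⟩ := hex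
    have hwfar : w ∈ farVertices G u := mem_farVertices.2 ⟨hwu, hw⟩
    have h1 := card_adj_farVertex_le_one ht (by omega) (by omega) ha hF hA hAu hBu hAB hadj hBbig
      hwfar
    have h2 : #{b ∈ U \ A | ¬ G.Adj b w} ≤ missingPairs G u := by
      refine le_trans (Finset.card_le_card (t := Finset.image Prod.fst _) ?_)
        (Finset.card_image_le (f := Prod.fst))
      intro b hb
      rw [Finset.mem_filter] at hb
      exact Finset.mem_image.2 ⟨(b, w), by simp [hBu b hb.1, hwfar, hb.2], rfl⟩
    have h3 := Finset.card_filter_add_card_filter_not (s := U \ A) (fun b => G.Adj b w)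
    omega
  have huA : u ∉ A := fun h => (hAu u h).ne rfl
  refine ⟨insert u A, u, by rw [Finset.card_insert_of_notMem huA, hA]; omega, hdom,
    fun v hv => ?_⟩
  simp only [Finset.mem_insert, not_or] at hv
  by_cases hall : ∀ w, G.Adj v w → w ∈ insert u A
  · exact .inl hall
  right
  have hnot : ∀ z₁ z₂, z₁ ∉ insert u A → z₂ ∉ insert u A → G.Adj z₁ z₂ → ∀ x ∈ A,
      ¬ G.Adj z₁ x := by
    intro z₁ z₂ h1 h2 h3 x hx
    simp only [Finset.mem_insert, not_or] at h1 h2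
    exact not_adj_core_of_adj ht (by omega) (by omega) ha hF hA hAu hBu hAB hadj hBbig h1.2 h2.2
      (hdom _ h1.1) (hdom _ h2.1) h3 hx
  have hvT : v ∉ insert u A := by simpa using hv
  push Not at hall
  obtain ⟨z, hvz, hz⟩ := hall
  refine ⟨fun w hw hvw => ?_, ?_⟩
  · rcases Finset.mem_insert.1 hw with h | h
    · exact h
    · exact absurd hvw (hnot v z hvT hz hvz w h)
  · obtain ⟨x, hx⟩ : A.Nonempty := Finset.card_pos.1 (by omega)
    -- An endpoint in `U \ A` would be adjacent to all of `A`, which `hnot` forbids. So these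
    -- neighbours of `v` lie in N(u) outside `U`, at most t(t - 1) vertices by `hmiss`.
    have hsub : ({w | G.Adj v w ∧ w ∉ insert u A} : Finset V) ⊆ G.neighborFinset u \ U := by
      intro w hw
      simp only [mem_filter, mem_univ, true_and] at hw
      obtain ⟨hvw, hw⟩ := hw
      have hw' := hw
      simp only [Finset.mem_insert, not_or] at hw'
      rw [Finset.mem_sdiff, mem_neighborFinset]
      exact ⟨hdom w hw'.1, fun hwU => hnot w v hw hvT hvw.symm x hx
        ((hcore w hwU hw'.2 x (hAU hx)).2 hx)⟩
    have h1 := Finset.card_le_card hsub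
    rw [Finset.card_sdiff_of_subset hUN, card_neighborFinset_eq_degree] at h1
    have h2 : #{w | G.Adj v w ∧ w ∉ insert u A} ≤ t * (t - 1) := by omega
    have h3 : (#{w | G.Adj v w ∧ w ∉ insert u A} : ℝ) ≤ t * (t - 1) := by
      have : (#{w | G.Adj v w ∧ w ∉ insert u A} : ℝ) ≤ ((t * (t - 1) : ℕ) : ℝ) := by
        exact_mod_cast h2
      push_cast [Nat.cast_sub (show 1 ≤ t by omega)] at this
      exact this
    obtain ⟨-, h4⟩ := qS_spec ht3 hn
    have ht' : (3 : ℝ) ≤ t := by exact_mod_cast ht3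
    have h5 : 2 * (t : ℝ) ^ 2 < qS n t := by nlinarith
    calc 2 * (t : ℝ) * #{w | G.Adj v w ∧ w ∉ insert u A}
        ≤ 2 * t * (t * (t - 1)) := mul_le_mul_of_nonneg_left h3 (by linarith)
      _ = (t - 1) * (2 * (t : ℝ) ^ 2) := by ring
      _ < (t - 1) * qS n t := mul_lt_mul_of_pos_left h5 (by linarith)

end Main

end SignlessLaplacian

theorem mainTheorem1 {k : ℕ} (hk : 2 ≤ k) (a : Fin k → ℕ) (ha : Antitone a)
    (ha_pos : ∀ i, 1 ≤ a i) (ha_one : 2 ≤ a ⟨0, by omega⟩)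
    (t : ℕ) (ht : t = ∑ i, a i)
    {V : Type*} [Fintype V] (n : ℕ) (hV : Fintype.card V = n)
    (hn : 8 * (t : ℤ) ^ 2 - 12 * (t : ℤ) + 9 ≤ (n : ℤ))
    (G : SimpleGraph V) (hG : (SignlessLaplacian.F a).Free G) :
    SignlessLaplacian.q G ≤ SignlessLaplacian.q (SignlessLaplacian.S n t) ∧
      (SignlessLaplacian.q G = SignlessLaplacian.q (SignlessLaplacian.S n t) ↔
        Nonempty (G ≃g SignlessLaplacian.S n t)) := by
  have ht3 : 3 ≤ t := by
    have h1 := ha_pos ⟨1, by omega⟩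
    have h2 : a ⟨0, by omega⟩ + a ⟨1, by omega⟩ ≤ t := by
      rw [ht, ← Finset.sum_pair (show (⟨0, by omega⟩ : Fin k) ≠ ⟨1, by omega⟩ by simp)]
      exact Finset.sum_le_sum_of_subset (Finset.subset_univ _)
    omega
  have hn' : 8 * (t : ℝ) ^ 2 - 12 * t + 9 ≤ n := by exact_mod_cast hn
  have : Nonempty V := by
    rw [← Fintype.card_pos_iff, hV]
    have : (0 : ℤ) < n := by nlinarith
    exact_mod_cast this
  have key : SignlessLaplacian.qS n t ≤ SignlessLaplacian.q G →
      SignlessLaplacian.q G ≤ SignlessLaplacian.qS n t ∧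
        Nonempty (G ≃g SignlessLaplacian.S n t) := fun hq => by
    obtain ⟨T, u, hT, hu, h⟩ := SignlessLaplacian.exists_core_of_qS_le ht ht3 hk ha_pos ha_one hG
      hn' hV hq
    exact SignlessLaplacian.q_le_and_nonempty_iso_of_core ht3 hn' G hV T hT hu h hq
  rw [SignlessLaplacian.q_S ht3 hn']
  refine ⟨?_, fun h => (key h.ge).2, fun ⟨e⟩ => ?_⟩
  · by_contra hlt
    exact hlt (key (not_le.1 hlt).le).1
  · rw [SignlessLaplacian.q_congr_iso e, SignlessLaplacian.q_S ht3 hn']
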